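/- Let $(M,g)$ be a compact smooth Riemannian manifold with boundary, $q\colon M\to\mathbb R$ smooth and $H_0\in\mathbb R$. An $H$-geodesic is a smooth curve $\gamma$ in $M$ with $\nabla_{\dot\gamma}\dot\gamma=-\nabla q(\gamma)$; its energy is the constant value of $\tfrac12|\dot\gamma|_g^2+q(\gamma)$. Let $S_{H_0}M$ be the set of $(x,\xi)\in TM$ with $\tfrac12|\xi|_g^2+q(x)=H_0$, let $\nu$ be the inward unit normal of $\partial M$ and $\Lambda(\xi,\eta)=\langle\nabla_\xi\eta,\nu\rangle$ its second fundamental form, and let $\partial_+S_{H_0}M=\{(x,\xi)\in S_{H_0}M: x\in\partial M,\ \langle\xi,\nu\rangle\ge 0\}$. For $(x,\xi)\in S_{H_0}M$ let $\gamma_{x,\xi}\colon[0,\tau(x,\xi)]\to M$ be the $H$-geodesic with initial data $(x,\xi)$, followed up to the time $\tau(x,\xi)$ at which it leaves $M$, and let $\exp^H_x$ be the partial map from $T_xM$ to $M$ with $\exp^H_x(t\xi)=\gamma_{x,\xi}(t)$ for $(x,\xi)\in S_{H_0}M$ and $t\ge0$ such that $\gamma_{x,\xi}$ stays in $M$ up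 to time $t$. The system $(M,g,q)$ is simple at energy $H_0$ if for each $x\in M$ the map $\exp^H_x$ is a diffeomorphism from its domain of definition onto $M$, and $\Lambda(\xi,\xi)>-d_xq(\nu(x))$ for all $x\in\partial M$ and $\xi\in T_x(\partial M)$ with $(x,\xi)\in S_{H_0}M$. A compact Riemannian manifold is simple if its boundary is strictly convex (its second fundamental form is positive definite) and for each $x$ the (partially defined) Riemannian exponential map $\exp_x$ is a diffeomorphism from its domain of definition onto $M$. Suppose that $(M,g,q)$ is simple at energy $H_0$. Then: 1. $\tilde g=2(H_0-q)g$ is a Riemannian metric, and $(M,\tilde g)$ is a simple Riemannian manifold. 2. If $\gamma\colon[0,T]\to M$ (with $T>0$) is an $H$-geodesic of energy $H_0$ and $s(t)=\int_0^t2(H_0-q(\gamma(u)))\,du$, then $s\colon[0,T]\to[0,s(T)]$ has a smooth, strictly increasing inverse $r$, and $\gamma\circ r$ is a unit speed geodesic of $\tilde g$ on $[0,s(T)]$. 3. Let $(x,\xi)\in\partial_+S_{H_0}M$, $\gamma=\gamma_{x,\xi}$, $\tau=\tau(x,\xi)$, and let $s$ and its inverse $r$ be as in 2 (with $T=\tau$).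 Then $\tilde\xi=\xi/(2(H_0-q(x)))$ is a $\tilde g$-unit vector that does not point out of $M$, the maximal $\tilde g$-geodesic with initial data $(x,\tilde\xi)$ is $\gamma\circ r\colon[0,s(\tau)]\to M$, and for every function $f\colon M\to\mathbb R$ that is integrable along $\gamma$ the function $f/(2(H_0-q))$ is integrable along $\gamma\circ r$ and $$I_{H_0}f(\gamma):=\int_0^{\tau}f(\gamma(t))\,dt=\int_0^{s(\tau)}\frac{f}{2(H_0-q)}\big(\gamma(r(\sigma))\big)\,d\sigma=:\tilde I\Big[\frac{f}{2(H_0-q)}\Big](\gamma\circ r),$$ where $\tilde I$ denotes the geodesic X-ray transform of $(M,\tilde g)$. -/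

import Mathlib

open Set MeasureTheory
open scoped Manifold ContDiff Matrix

noncomputable section

namespace PotentialRay

/-- `ℝᵈ`, the space in which the charts of a `d`-dimensional manifold take their values. -/
abbrev Coord (d : ℕ) : Type := EuclideanSpace ℝ (Fin d)

/-- A smooth Riemannian metric on a `d`-dimensional smooth manifold with boundary. -/
abbrev Metric (d : ℕ) [NeZero d] (M : Type*) [TopologicalSpace M]
    [ChartedSpace (EuclideanHalfSpace d) M] [IsManifold (𝓡∂ d) ∞ M] : Type _ :=
  Bundle.ContMDiffRiemannianMetric (𝓡∂ d) ∞ (Coord d)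
    (fun x : M => TangentSpace (𝓡∂ d) x)

section Charts

/-! ### Calculus in the charts

The chart around `z` takes values in the half space `{y | 0 ≤ y 0}`, which is the range of `𝓡∂ d`.
Derivatives are taken within this half space. -/

/-- The `k`-th partial derivative, within the half space, of a function of the coordinates. -/
def pd {d : ℕ} [NeZero d] (k : Fin d) (u : Coord d → ℝ) (y : Coord d) : ℝ :=
  fderivWithin ℝ u (range (𝓡∂ d)) y (EuclideanSpace.single k 1)

variable {d : ℕ} [NeZero d] {M : Type*} [TopologicalSpace M]
  [ChartedSpace (EuclideanHalfSpace d) M]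

/-- The coordinate vector field `∂ᵢ` of the chart around `z`, at the point with coordinates `y`. -/
def coordVector (z : M) (i : Fin d) (y : Coord d) :
    TangentSpace (𝓡∂ d) ((extChartAt (𝓡∂ d) z).symm y) :=
  mfderivWithin 𝓘(ℝ, Coord d) (𝓡∂ d) (extChartAt (𝓡∂ d) z).symm (range (𝓡∂ d)) y
    (EuclideanSpace.single i 1 : Coord d)

variable [IsManifold (𝓡∂ d) ∞ M]

/-- The matrix `(gᵢⱼ)` of the metric in the chart around `z`. -/
def gram (g : Metric d M) (z : M) (y : Coord d) : Matrix (Fin d) (Fin d) ℝ :=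
  Matrix.of fun i j =>
    g.inner ((extChartAt (𝓡∂ d) z).symm y) (coordVector z i y) (coordVector z j y)

/-- The Christoffel symbol `Γᵏᵢⱼ` of the Levi-Civita connection in the chart around `z`. -/
def christoffel (g : Metric d M) (z : M) (k i j : Fin d) (y : Coord d) : ℝ :=
  (1 / 2) * ∑ l, (gram g z y)⁻¹ k l *
    (pd i (fun y' => gram g z y' j l) y + pd j (fun y' => gram g z y' i l) y
      - pd l (fun y' => gram g z y' i j) y)

/-- The `k`-th component of the gradient `∇q` in the chart around `z`. -/
def gradComp (g : Metric d M) (q : M → ℝ) (z : M) (k : Fin d) (y : Coord d) : ℝ :=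
  ∑ l, (gram g z y)⁻¹ k l * pd l (fun y' => q ((extChartAt (𝓡∂ d) z).symm y')) y

end Charts

section Curves

variable {d : ℕ} [NeZero d] {M : Type*} [TopologicalSpace M]
  [ChartedSpace (EuclideanHalfSpace d) M]

/-- The point `(γ t, γ' t)` of the tangent bundle, for a curve `γ` defined on the interval `J`. -/
def lift (γ : ℝ → M) (J : Set ℝ) (t : ℝ) : TangentBundle (𝓡∂ d) M :=
  ⟨γ t, mfderivWithin 𝓘(ℝ, ℝ) (𝓡∂ d) γ J t (1 : ℝ)⟩

/-- The curve `γ` in the coordinates of the chart around `z`. -/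
def coordCurve (d : ℕ) [NeZero d] {M : Type*} [TopologicalSpace M]
    [ChartedSpace (EuclideanHalfSpace d) M] (z : M) (γ : ℝ → M) (t : ℝ) : Coord d :=
  extChartAt (𝓡∂ d) z (γ t)

variable [IsManifold (𝓡∂ d) ∞ M]

/-- `γ` is a smooth curve in `M` on the nondegenerate interval `J` (with one-sided derivatives at
endpoints) that solves Newton's equation `∇_γ' γ' = - ∇q(γ)`, written in local coordinates. -/
def IsHGeodesicOn (g : Metric d M) (q : M → ℝ) (γ : ℝ → M) (J : Set ℝ) : Prop :=
  ContMDiffOn 𝓘(ℝ, ℝ) (𝓡∂ d) ∞ γ J ∧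
  ∀ t ∈ J, ∀ z : M, γ t ∈ (extChartAt (𝓡∂ d) z).source → ∀ k : Fin d,
    derivWithin (derivWithin (coordCurve d z γ) J) J t k
      + ∑ i, ∑ j, christoffel g z k i j (coordCurve d z γ t)
          * derivWithin (coordCurve d z γ) J t i * derivWithin (coordCurve d z γ) J t j
      = - gradComp g q z k (coordCurve d z γ t)

/-- Geodesics of the metric `g` (with an affine parameter): the equation `∇_γ' γ' = 0`. -/
def IsGeodesicOn (g : Metric d M) (γ : ℝ → M) (J : Set ℝ) : Prop :=
  IsHGeodesicOn g (fun _ => 0) γ J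

/-- The energy `|ξ|²/2 + q(x)` of a point `(x, ξ)` of the tangent bundle. -/
def energy (g : Metric d M) (q : M → ℝ) (p : TangentBundle (𝓡∂ d) M) : ℝ :=
  (1 / 2) * g.inner p.1 p.2 p.2 + q p.1

/-- `y = π(φ_t(p))` for the potential flow `φ_t`, `t ≥ 0`: the `H`-geodesic with initial point and
velocity `p` is defined (stays in `M`) up to time `t`, and is then at `y`. -/
def FlowsTo (g : Metric d M) (q : M → ℝ) (p : TangentBundle (𝓡∂ d) M) (t : ℝ) (y : M) : Prop :=
  (t = 0 ∧ y = p.1) ∨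
  (0 < t ∧ ∃ γ : ℝ → M, IsHGeodesicOn g q γ (Icc 0 t) ∧ lift γ (Icc 0 t) 0 = p ∧ γ t = y)

open Classical in
/-- The point `π(φ_t(p))`, for `t` between `0` and the exit time (elsewhere, the base point). -/
def flowPoint (g : Metric d M) (q : M → ℝ) (p : TangentBundle (𝓡∂ d) M) (t : ℝ) : M :=
  if h : ∃ y, FlowsTo g q p t y then h.choose else p.1

/-- The time `τ(p)` at which the `H`-geodesic with initial data `p` leaves `M`. -/
def exitTime (g : Metric d M) (q : M → ℝ) (p : TangentBundle (𝓡∂ d) M) : ℝ :=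
  sSup {t : ℝ | ∃ y, FlowsTo g q p t y}

/-- The transform `f ↦ ∫₀^τ f(γ(t)) dt` along the `H`-geodesic `γ` with initial data `p`. -/
def flowTransform (g : Metric d M) (q : M → ℝ) (f : M → ℝ) (p : TangentBundle (𝓡∂ d) M) : ℝ :=
  ∫ t in (0 : ℝ)..exitTime g q p, f (flowPoint g q p t)

/-- The geodesic X-ray transform of `f` with respect to `g`, along the geodesic with initial data
`p` (where `p` is a unit vector). -/
def xrayTransform (g : Metric d M) (f : M → ℝ) (p : TangentBundle (𝓡∂ d) M) : ℝ :=
  flowTransform g (fun _ => 0) f p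

end Curves

section Boundary

/-! ### The boundary

At a boundary point `x`, the tangent space is `ℝᵈ` through the chart around `x`; vectors with zeroth
coordinate `0` are tangent to the boundary, and those with positive zeroth coordinate point
inwards. -/

variable {d : ℕ} [NeZero d] {M : Type*} [TopologicalSpace M]
  [ChartedSpace (EuclideanHalfSpace d) M]

/-- `ξ ∈ T_x(∂M)`, for a boundary point `x`. -/
def IsTangentToBoundary (x : M) (ξ : TangentSpace (𝓡∂ d) x) : Prop :=
  (show Coord d from ξ) 0 = 0

variable [IsManifold (𝓡∂ d) ∞ M]

/-- The inward unit normal `ν(x)` at a boundary point `x`, with components `g⁰ᵏ / √g⁰⁰`. -/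
def normal (g : Metric d M) (x : M) : TangentSpace (𝓡∂ d) x :=
  (WithLp.toLp 2 fun k =>
    (gram g x (extChartAt (𝓡∂ d) x x))⁻¹ 0 k
      / √((gram g x (extChartAt (𝓡∂ d) x x))⁻¹ 0 0) : Coord d)

/-- The second fundamental form `Λ(ξ, η) = ⟨∇_ξ η, ν⟩` of the boundary at `x`, for `ξ` and `η`
tangent to the boundary. Here `η` is extended with constant coordinates, hence tangentially to the
boundary, so that the covariant derivative has the components `Γᵏᵢⱼ ξⁱ ηʲ`. -/
def secondFundamentalForm (g : Metric d M) (x : M) (ξ η : TangentSpace (𝓡∂ d) x) : ℝ :=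
  g.inner x
    (WithLp.toLp 2 fun k => ∑ i, ∑ j, christoffel g x k i j (extChartAt (𝓡∂ d) x x)
      * (show Coord d from ξ) i * (show Coord d from η) j : Coord d)
    (normal g x)

/-- Strict convexity of the boundary for the potential system at energy `H₀`:
`Λ(ξ, ξ) > - d_x q(ν(x))` for all `ξ` of energy `H₀` tangent to the boundary at `x`. -/
def StrictlyHConvexBoundary (g : Metric d M) (q : M → ℝ) (H₀ : ℝ) : Prop :=
  ∀ x ∈ (𝓡∂ d).boundary M, ∀ ξ : TangentSpace (𝓡∂ d) x, IsTangentToBoundary x ξ →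
    energy g q ⟨x, ξ⟩ = H₀ →
    - (show ℝ from mfderiv (𝓡∂ d) 𝓘(ℝ, ℝ) q x (normal g x)) < secondFundamentalForm g x ξ ξ

/-- Strict convexity of the boundary: its second fundamental form is positive definite. -/
def StrictlyConvexBoundary (g : Metric d M) : Prop :=
  ∀ x ∈ (𝓡∂ d).boundary M, ∀ ξ : TangentSpace (𝓡∂ d) x, IsTangentToBoundary x ξ → ξ ≠ 0 →
    0 < secondFundamentalForm g x ξ ξ

/-- The vectors at boundary points that do not point out of `M`: `⟨ξ, ν⟩ ≥ 0`. -/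
def inwardVectors (g : Metric d M) : Set (TangentBundle (𝓡∂ d) M) :=
  {p | p.1 ∈ (𝓡∂ d).boundary M ∧ 0 ≤ g.inner p.1 p.2 (normal g p.1)}

/-- `∂₊ S_{H₀} M`. -/
def inwardEnergyBundle (g : Metric d M) (q : M → ℝ) (H₀ : ℝ) : Set (TangentBundle (𝓡∂ d) M) :=
  {p | p ∈ inwardVectors g ∧ energy g q p = H₀}

/-- `∂₊ S M`, with unit vectors. -/
def inwardUnitBundle (g : Metric d M) : Set (TangentBundle (𝓡∂ d) M) :=
  {p | p ∈ inwardVectors g ∧ g.inner p.1 p.2 p.2 = 1}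

end Boundary

section Simple

variable {d : ℕ} [NeZero d] {M : Type*} [TopologicalSpace M]
  [ChartedSpace (EuclideanHalfSpace d) M]

/-- The partial map with graph `R`, from the tangent space at `x` to `M`, is a diffeomorphism of its
domain of definition onto `M`: it is single-valued and smooth on this domain (`F` is the map), and
it has a smooth inverse `G`, defined on all of `M`. -/
def IsDiffeoOnto (x : M) (R : TangentSpace (𝓡∂ d) x → M → Prop) : Prop :=
  ∃ (F : Coord d → M) (G : M → Coord d),
    ContMDiffOn 𝓘(ℝ, Coord d) (𝓡∂ d) ∞ F {v | ∃ y, R v y} ∧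
    ContMDiff (𝓡∂ d) 𝓘(ℝ, Coord d) ∞ G ∧
    (∀ v y, R v y → F v = y) ∧
    (∀ v y, R v y ↔ G y = v)

variable [IsManifold (𝓡∂ d) ∞ M]

/-- The graph of the partial map `exp_x^H`, given by `exp_x^H(t ξ) = π(φ_t(x, ξ))` for `t ≥ 0` and
`(x, ξ)` of energy `H₀`. -/
def HExp (g : Metric d M) (q : M → ℝ) (H₀ : ℝ) (x : M) (v : TangentSpace (𝓡∂ d) x) (y : M) : Prop :=
  ∃ (t : ℝ) (ξ : TangentSpace (𝓡∂ d) x),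
    0 ≤ t ∧ energy g q ⟨x, ξ⟩ = H₀ ∧ v = t • ξ ∧ FlowsTo g q ⟨x, ξ⟩ t y

/-- The graph of the Riemannian exponential map: `exp_x(v) = σ(1)` for the geodesic `σ` in `M` with
`σ(0) = x` and `σ'(0) = v`. -/
def RiemExp (g : Metric d M) (x : M) (v : TangentSpace (𝓡∂ d) x) (y : M) : Prop :=
  ∃ σ : ℝ → M, IsGeodesicOn g σ (Icc 0 1) ∧ lift σ (Icc 0 1) 0 = ⟨x, v⟩ ∧ σ 1 = y

/-- `(M, g, q)` is simple at energy `H₀`. -/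
def IsSimpleAtEnergy (g : Metric d M) (q : M → ℝ) (H₀ : ℝ) : Prop :=
  StrictlyHConvexBoundary g q H₀ ∧ ∀ x : M, IsDiffeoOnto x (HExp g q H₀ x)

/-- `(M, g)` is a simple Riemannian manifold (`M` being compact). -/
def IsSimpleRiemannian (g : Metric d M) : Prop :=
  StrictlyConvexBoundary g ∧ ∀ x : M, IsDiffeoOnto x (RiemExp g x)

end Simple

end PotentialRay

end

/-!
The statement rests on Maupertuis' principle: on the energy level `H₀`, the trajectories of the
system `(g, q)` are, up to a change of parameter, the unit speed geodesics of the Jacobi metric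
`g' = ρ g`, with `ρ = 2 (H₀ - q)`.

*Positivity of `ρ`.* Vectors of energy `H₀` at `x` have `|ξ|² = ρ(x)`. If `ρ(x)` were zero,
`exp_x^H` would be defined at `0` only, and could not be onto `M`, since a manifold of dimension
`d ≥ 1` with boundary is not a point (`jacobiFactor_pos`).

*Change of parameter.* `IsHGeodesicOn.maupertuis` treats two systems with `g₂ = κ g₁` and
`E₁ - q₁ = κ (E₂ - q₂)` symmetrically: the conformal change of the Christoffel symbols, conservation
of energy and `dr/ds = 1/κ` turn one equation of motion into the other. It is applied with
`κ = ρ` from `(g, q, H₀)` to `(g', 0, 1/2)`, and with `κ = 1/ρ` in the other direction; together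
these give `flowsTo_jacobi_iff`, the correspondence of the two flows.

*Uniqueness.* Uniqueness for the initial value problem is not needed from the theory of ordinary
differential equations: two trajectories of energy `H₀` with the same initial data agree because
`exp_x^H` is single-valued. For `g'` it follows by the correspondence, and geodesics with zero
velocity are constant by conservation of energy. The exit time is attained because the domain of
`exp_x^H` is the image of the compact manifold `M` under the inverse `G` of `exp_x^H`. The identity
of the two ray transforms is then the substitution `s = s(t)` in an integral.

*The exponential map of `g'`* (`isDiffeoOnto_riemExp`). Its inverse is `G' = c G`, where
`c(y) = ρ(x)⁻¹ ∫₀¹ ρ(exp_x^H(a G(y))) da` is `ρ(x)⁻¹` times the mean speed of the change of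
parameter along the trajectory from `x` to `y`. This is smooth on `M`, as an integral depending on
a parameter. The map `G'` is injective, and it is an immersion: a vector in the kernel of `dG'`
has `dG`-image on the line through `G(y)`, hence is a multiple of the velocity of the trajectory, on
which `dG'` does not vanish. The inverse of an injective immersion of a compact manifold into a
vector space of the same dimension is smooth on the image, also at the boundary
(`contMDiffOn_leftInverse_of_immersion`).

*The boundary* (`strictlyConvexBoundary_jacobi`). For `ξ` tangent to the boundary, the conformal
change of the Christoffel symbols adds to `Γ⁰ᵢⱼ ξⁱ ξʲ` the term `|ξ|² ρ⁻¹ (∇q)⁰`. Convexity for `g'`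
at `ξ` is therefore `H`-convexity at the multiple of `ξ` that has energy `H₀`.
-/

namespace PotentialRay

/-! ### The metric in coordinates -/

variable {d : ℕ} [NeZero d] {M : Type*} [TopologicalSpace M]
  [ChartedSpace (EuclideanHalfSpace d) M]

/-- The velocity of a curve, as an element of the model space `ℝᵈ`. -/
noncomputable def velocity (γ : ℝ → M) (J : Set ℝ) (t : ℝ) : Coord d :=
  mfderivWithin 𝓘(ℝ, ℝ) (𝓡∂ d) γ J t (1 : ℝ)

/-- The coordinate vector field `∂ᵢ`, as an element of the model space `ℝᵈ`. -/
noncomputable def coordVec (z : M) (i : Fin d) (y : Coord d) : Coord d :=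
  coordVector z i y

theorem lift_eq_iff {γ : ℝ → M} {J : Set ℝ} {t : ℝ} {x : M} {ξ : TangentSpace (𝓡∂ d) x} :
    lift γ J t = (⟨x, ξ⟩ : TangentBundle (𝓡∂ d) M) ↔
      γ t = x ∧ velocity γ J t = (show Coord d from ξ) := by
  constructor
  · intro h
    have h1 : γ t = x := congrArg Bundle.TotalSpace.proj h
    subst h1
    refine ⟨rfl, ?_⟩
    exact eq_of_heq (Bundle.TotalSpace.mk.inj h).2
  · rintro ⟨rfl, h⟩
    exact congrArg (Bundle.TotalSpace.mk (γ t)) h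

variable [IsManifold (𝓡∂ d) ∞ M]

/-- The inner product of the tangent space at `x`, as a bilinear form on the model space `ℝᵈ`. -/
noncomputable def innerAt (g : Metric d M) (x : M) : Coord d →L[ℝ] Coord d →L[ℝ] ℝ := g.inner x

theorem innerAt_symm (g : Metric d M) (x : M) (v w : Coord d) :
    innerAt g x v w = innerAt g x w v := g.symm x v w

theorem innerAt_pos (g : Metric d M) (x : M) {v : Coord d} (hv : v ≠ 0) :
    0 < innerAt g x v v := g.pos x v hv

theorem innerAt_self_nonneg (g : Metric d M) (x : M) (v : Coord d) :
    0 ≤ innerAt g x v v := by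
  by_cases hv : v = 0
  · simp [hv]
  · exact (innerAt_pos g x hv).le

theorem gram_apply (g : Metric d M) (z : M) (y : Coord d) (i j : Fin d) :
    gram g z y i j =
      innerAt g ((extChartAt (𝓡∂ d) z).symm y) (coordVec z i y) (coordVec z j y) := rfl

/-- The components of the metric are smooth in the coordinates, since `∂ᵢ` is a smooth section of
the tangent bundle along the inverse chart. -/
theorem contDiffOn_gram (g : Metric d M) (z : M) (i j : Fin d) :
    ContDiffOn ℝ ∞ (fun y => gram g z y i j) (extChartAt (𝓡∂ d) z).target := by
  have hT : ∀ i : Fin d, ContMDiffOn 𝓘(ℝ, Coord d) ((𝓡∂ d).prod 𝓘(ℝ, Coord d)) ∞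
      (fun y => (Bundle.TotalSpace.mk' (Coord d) ((extChartAt (𝓡∂ d) z).symm y)
        (coordVector z i y) : TangentBundle (𝓡∂ d) M)) (extChartAt (𝓡∂ d) z).target := by
    intro i
    have hs := contMDiffOn_extChartAt_symm (I := 𝓡∂ d) (n := ∞) z
    have hU : UniqueMDiffOn 𝓘(ℝ, Coord d) (extChartAt (𝓡∂ d) z).target :=
      (uniqueDiffOn_extChartAt_target z).uniqueMDiffOn
    have h1 := hs.contMDiffOn_tangentMapWithin (m := ∞) (by simp) hU
    have h2 : ContMDiff 𝓘(ℝ, Coord d) (𝓘(ℝ, Coord d).prod 𝓘(ℝ, Coord d)) ∞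
      (fun y : Coord d => (⟨y, (EuclideanSpace.single i 1 : Coord d)⟩ :
        TangentBundle 𝓘(ℝ, Coord d) (Coord d))) := by
      exact contMDiff_vectorSpace_iff_contDiff.2
        (contDiff_const (c := (EuclideanSpace.single i 1 : Coord d)))
    refine (h1.comp h2.contMDiffOn (fun y hy => hy)).congr ?_
    intro y hy
    simp only [Function.comp, tangentMapWithin, coordVector, Bundle.TotalSpace.mk']
    congr 1
    have := (mfderivWithin_subset (I := 𝓘(ℝ, Coord d)) (I' := 𝓡∂ d)
      (f := (extChartAt (𝓡∂ d) z).symm) (extChartAt_target_subset_range (I := 𝓡∂ d) z)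
      (hU y hy) (mdifferentiableWithinAt_extChartAt_symm hy))
    rw [this]
  have h3 : ContMDiffOn 𝓘(ℝ, Coord d) ((𝓡∂ d).prod 𝓘(ℝ)) ∞
      (fun y => Bundle.TotalSpace.mk' ℝ (E := Bundle.Trivial M ℝ) ((extChartAt (𝓡∂ d) z).symm y)
        (g.inner ((extChartAt (𝓡∂ d) z).symm y) (coordVector z i y) (coordVector z j y)))
      (extChartAt (𝓡∂ d) z).target := by
    apply ContMDiffOn.clm_bundle_apply₂ (F₁ := Coord d) (F₂ := Coord d)
    · exact g.contMDiff.comp_contMDiffOn (contMDiffOn_extChartAt_symm z)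
    · exact hT i
    · exact hT j
  rw [← contMDiffOn_iff_contDiffOn]
  intro y hy
  have := h3 y hy
  simp only [Bundle.contMDiffWithinAt_totalSpace] at this
  exact this.2

/-- The differential of the inverse chart, on the model space. -/
noncomputable def chartSymmDeriv (z : M) (y : Coord d) : Coord d →L[ℝ] Coord d :=
  mfderivWithin 𝓘(ℝ, Coord d) (𝓡∂ d) (extChartAt (𝓡∂ d) z).symm (range (𝓡∂ d)) y

omit [IsManifold (𝓡∂ d) ∞ M] in
theorem chartSymmDeriv_apply (z : M) (y v : Coord d) :
    chartSymmDeriv z y v = ∑ i, v i • coordVec z i y := by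
  have hv : v = ∑ i, v i • (EuclideanSpace.single i 1 : Coord d) := by
    ext j
    simp [Finset.sum_apply, Pi.single_apply]
  conv_lhs => rw [hv]
  rw [map_sum]
  simp only [map_smul]
  rfl

theorem gram_dotProduct (g : Metric d M) (z : M) (y v w : Coord d) :
    ∑ i, ∑ j, gram g z y i j * v i * w j =
      innerAt g ((extChartAt (𝓡∂ d) z).symm y) (chartSymmDeriv z y v) (chartSymmDeriv z y w) := by
  simp only [chartSymmDeriv_apply, map_sum, map_smul, sum_apply,
    smul_apply, gram_apply, smul_eq_mul, Finset.mul_sum]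
  rw [Finset.sum_comm]
  refine Finset.sum_congr rfl fun i _ => Finset.sum_congr rfl fun j _ => by ring

theorem chartSymmDeriv_injective (z : M) {y : Coord d} (hy : y ∈ (extChartAt (𝓡∂ d) z).target) :
    Function.Injective (chartSymmDeriv z y) := by
  have h := isInvertible_mfderivWithin_extChartAt_symm (I := 𝓡∂ d) (x := z) hy
  exact h.injective

theorem gram_posDef (g : Metric d M) (z : M) {y : Coord d}
    (hy : y ∈ (extChartAt (𝓡∂ d) z).target) : (gram g z y).PosDef := by
  refine Matrix.PosDef.of_dotProduct_mulVec_pos ?_ ?_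
  · ext i j
    simp [gram_apply, innerAt_symm g _ (coordVec z i y)]
  · intro v hv
    have h := gram_dotProduct g z y (WithLp.toLp 2 v) (WithLp.toLp 2 v)
    have : star v ⬝ᵥ gram g z y *ᵥ v = ∑ i, ∑ j, gram g z y i j * v i * v j := by
      simp only [dotProduct, Matrix.mulVec, Finset.mul_sum]
      refine Finset.sum_congr rfl fun i _ => Finset.sum_congr rfl fun j _ => by simp; ring
    rw [this]
    refine h.symm ▸ innerAt_pos g _ ?_
    intro h0
    apply hv
    have := chartSymmDeriv_injective z hy (h0.trans (map_zero _).symm)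
    simpa using this

end PotentialRay

namespace PotentialRay

/-! ### Contractions of the Christoffel symbols -/

section Algebra

variable {d : ℕ}

/-- The covector `l ↦ ½ (∂ᵢAⱼₗ + ∂ⱼAᵢₗ - ∂ₗAᵢⱼ) vⁱ vʲ`, where `D l i j` stands for `∂ₗAᵢⱼ`. Raising
its index gives `Γᵏᵢⱼ vⁱ vʲ`. -/
noncomputable def loweredChristoffel (D : Fin d → Fin d → Fin d → ℝ) (v : Fin d → ℝ) :
    Fin d → ℝ :=
  fun l => (1 / 2) * ∑ i, ∑ j, (D i j l + D j i l - D l i j) * v i * v j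

theorem dotProduct_loweredChristoffel (D : Fin d → Fin d → Fin d → ℝ) (v : Fin d → ℝ) :
    v ⬝ᵥ loweredChristoffel D v = (1 / 2) * ∑ l, ∑ i, ∑ j, D l i j * v l * v i * v j := by
  have h1 : ∑ l, ∑ i, ∑ j, D i j l * v i * v j * v l =
      ∑ l, ∑ i, ∑ j, D l i j * v l * v i * v j := by
    rw [Finset.sum_comm]
    refine Finset.sum_congr rfl fun i _ => ?_
    rw [Finset.sum_comm]
  have h2 : ∑ l, ∑ i, ∑ j, D j i l * v i * v j * v l =
      ∑ l, ∑ i, ∑ j, D l i j * v l * v i * v j := by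
    rw [← h1]
    refine Finset.sum_congr rfl fun l _ => ?_
    rw [Finset.sum_comm]
    refine Finset.sum_congr rfl fun i _ => Finset.sum_congr rfl fun j _ => by ring
  have h3 : ∑ l, ∑ i, ∑ j, D l i j * v i * v j * v l =
      ∑ l, ∑ i, ∑ j, D l i j * v l * v i * v j :=
    Finset.sum_congr rfl fun l _ => Finset.sum_congr rfl fun i _ =>
      Finset.sum_congr rfl fun j _ => by ring
  have h4 : v ⬝ᵥ loweredChristoffel D v = (1 / 2) * (∑ l, ∑ i, ∑ j, D i j l * v i * v j * v l
      + ∑ l, ∑ i, ∑ j, D j i l * v i * v j * v l - ∑ l, ∑ i, ∑ j, D l i j * v i * v j * v l) := by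
    simp only [dotProduct, loweredChristoffel, Finset.mul_sum, ← Finset.sum_add_distrib,
      ← Finset.sum_sub_distrib]
    refine Finset.sum_congr rfl fun l _ => Finset.sum_congr rfl fun i _ =>
      Finset.sum_congr rfl fun j _ => by ring
  rw [h4, h1, h2, h3]
  ring

/-- The effect of `g ↦ κ g`, whose derivatives are `κ ∂ₗgᵢⱼ + Kₗ gᵢⱼ` with `K = dκ`. -/
theorem loweredChristoffel_conformal (D : Fin d → Fin d → Fin d → ℝ) (A : Matrix (Fin d) (Fin d) ℝ)
    (hA : A.IsSymm) (K v : Fin d → ℝ) (κ : ℝ) :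
    loweredChristoffel (fun l i j => κ * D l i j + K l * A i j) v
      = κ • loweredChristoffel D v + (K ⬝ᵥ v) • (A *ᵥ v) - (1 / 2 * (v ⬝ᵥ A *ᵥ v)) • K := by
  ext l
  have hs : ∀ i, A l i = A i l := fun i => hA.apply i l
  have h1 : ∑ i, ∑ j, K i * A j l * v i * v j = (K ⬝ᵥ v) * (A *ᵥ v) l := by
    simp only [dotProduct, Matrix.mulVec, Finset.sum_mul_sum, hs]
    exact Finset.sum_congr rfl fun i _ => Finset.sum_congr rfl fun j _ => by ring
  have h2 : ∑ i, ∑ j, K j * A i l * v i * v j = (K ⬝ᵥ v) * (A *ᵥ v) l := by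
    rw [← h1, Finset.sum_comm]
    exact Finset.sum_congr rfl fun i _ => Finset.sum_congr rfl fun j _ => by ring
  have h3 : ∑ i, ∑ j, K l * A i j * v i * v j = (v ⬝ᵥ A *ᵥ v) * K l := by
    simp only [dotProduct, Matrix.mulVec, Finset.mul_sum, Finset.sum_mul]
    exact Finset.sum_congr rfl fun i _ => Finset.sum_congr rfl fun j _ => by ring
  have h4 : loweredChristoffel (fun l i j => κ * D l i j + K l * A i j) v l
      = κ * loweredChristoffel D v l + (1 / 2) * (∑ i, ∑ j, K i * A j l * v i * v j
        + ∑ i, ∑ j, K j * A i l * v i * v j - ∑ i, ∑ j, K l * A i j * v i * v j) := by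
    simp only [loweredChristoffel, Finset.mul_sum, ← Finset.sum_add_distrib,
      ← Finset.sum_sub_distrib]
    exact Finset.sum_congr rfl fun i _ => Finset.sum_congr rfl fun j _ => by ring
  rw [h4, h1, h2, h3]
  simp only [Pi.add_apply, Pi.sub_apply, Pi.smul_apply, smul_eq_mul]
  ring

theorem loweredChristoffel_smul (D : Fin d → Fin d → Fin d → ℝ) (c : ℝ) (v : Fin d → ℝ) :
    loweredChristoffel D (c • v) = c ^ 2 • loweredChristoffel D v := by
  ext l
  simp only [loweredChristoffel, Pi.smul_apply, smul_eq_mul, Finset.mul_sum]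
  exact Finset.sum_congr rfl fun i _ => Finset.sum_congr rfl fun j _ => by ring

end Algebra

variable {d : ℕ} [NeZero d] {M : Type*} [TopologicalSpace M]
  [ChartedSpace (EuclideanHalfSpace d) M]

section Charts
variable [IsManifold (𝓡∂ d) ∞ M]

theorem christoffel_contract (g : Metric d M) (z : M) (y : Coord d) (v : Fin d → ℝ) (k : Fin d) :
    ∑ i, ∑ j, christoffel g z k i j y * v i * v j =
      ((gram g z y)⁻¹ *ᵥ
        loweredChristoffel (fun l i j => pd l (fun y' => gram g z y' i j) y) v) k := by
  simp only [christoffel, Matrix.mulVec, dotProduct, loweredChristoffel, Finset.mul_sum,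
    Finset.sum_mul]
  rw [Finset.sum_comm]
  conv_rhs => rw [Finset.sum_comm]
  rw [Finset.sum_comm]
  refine Finset.sum_congr rfl fun i _ => ?_
  rw [Finset.sum_comm]
  exact Finset.sum_congr rfl fun i _ => Finset.sum_congr rfl fun j _ => by ring

theorem gradComp_eq (g : Metric d M) (q : M → ℝ) (z : M) (k : Fin d) (y : Coord d) :
    gradComp g q z k y = ((gram g z y)⁻¹ *ᵥ
      fun l => pd l (fun y' => q ((extChartAt (𝓡∂ d) z).symm y')) y) k := rfl

end Charts

/-! ### Differentiation within the half space -/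

theorem fderivWithin_eq_sum_pd (u : Coord d → ℝ) (y v : Coord d) :
    fderivWithin ℝ u (range (𝓡∂ d)) y v = ∑ l, pd l u y * v l := by
  have hv : v = ∑ i, v i • (EuclideanSpace.single i 1 : Coord d) := by
    ext j
    simp [Finset.sum_apply, Pi.single_apply]
  conv_lhs => rw [hv]
  simp only [map_sum, map_smul, smul_eq_mul]
  exact Finset.sum_congr rfl fun i _ => mul_comm _ _

theorem target_mem_nhdsWithin_range (z : M) {y : Coord d} (hy : y ∈ (extChartAt (𝓡∂ d) z).target) :
    (extChartAt (𝓡∂ d) z).target ∈ nhdsWithin y (range (𝓡∂ d)) :=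
  extChartAt_target_mem_nhdsWithin_of_mem hy

theorem uniqueDiffWithinAt_range {z : M} {y : Coord d} (hy : y ∈ (extChartAt (𝓡∂ d) z).target) :
    UniqueDiffWithinAt ℝ (range (𝓡∂ d)) y :=
  (𝓡∂ d).uniqueDiffOn _ (extChartAt_target_subset_range z hy)

theorem coordCurve_mem_range (z : M) (γ : ℝ → M) (t : ℝ) :
    coordCurve d z γ t ∈ range (𝓡∂ d) := by
  simp [coordCurve, extChartAt]

/-- The chain rule for a function on the half space along the coordinates of a curve. -/
theorem hasDerivWithinAt_comp_coordCurve {u : Coord d → ℝ} {z : M} {γ : ℝ → M} {J : Set ℝ} {t : ℝ}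
    {v : Coord d}
    (hu : DifferentiableWithinAt ℝ u (range (𝓡∂ d)) (coordCurve d z γ t))
    (hc : HasDerivWithinAt (coordCurve d z γ) v J t) :
    HasDerivWithinAt (fun s => u (coordCurve d z γ s))
      (∑ l, pd l u (coordCurve d z γ t) * v l) J t := by
  rw [← fderivWithin_eq_sum_pd]
  exact hu.hasFDerivWithinAt.comp_hasDerivWithinAt t hc (fun s _ => coordCurve_mem_range z γ s)

section Smooth
variable [IsManifold (𝓡∂ d) ∞ M]

theorem contDiffOn_comp_symm {u : M → ℝ} (hu : ContMDiff (𝓡∂ d) 𝓘(ℝ, ℝ) ∞ u) (z : M) :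
    ContDiffOn ℝ ∞ (fun y => u ((extChartAt (𝓡∂ d) z).symm y)) (extChartAt (𝓡∂ d) z).target := by
  rw [← contMDiffOn_iff_contDiffOn]
  exact hu.comp_contMDiffOn (contMDiffOn_extChartAt_symm z)

theorem differentiableWithinAt_comp_symm {u : M → ℝ} (hu : ContMDiff (𝓡∂ d) 𝓘(ℝ, ℝ) ∞ u) (z : M)
    {y : Coord d} (hy : y ∈ (extChartAt (𝓡∂ d) z).target) :
    DifferentiableWithinAt ℝ (fun y => u ((extChartAt (𝓡∂ d) z).symm y)) (range (𝓡∂ d)) y :=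
  ((contDiffOn_comp_symm hu z).differentiableOn (by simp) y hy).mono_of_mem_nhdsWithin
    (target_mem_nhdsWithin_range z hy)

theorem differentiableWithinAt_gram (g : Metric d M) (z : M) (i j : Fin d)
    {y : Coord d} (hy : y ∈ (extChartAt (𝓡∂ d) z).target) :
    DifferentiableWithinAt ℝ (fun y => gram g z y i j) (range (𝓡∂ d)) y :=
  ((contDiffOn_gram g z i j).differentiableOn (by simp) y hy).mono_of_mem_nhdsWithin
    (target_mem_nhdsWithin_range z hy)

/-! ### Curves in coordinates -/

theorem contDiffWithinAt_coordCurve {γ : ℝ → M} {J : Set ℝ} {t : ℝ} {z : M}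
    (hγ : ContMDiffWithinAt 𝓘(ℝ, ℝ) (𝓡∂ d) ∞ γ J t) (hz : γ t ∈ (extChartAt (𝓡∂ d) z).source) :
    ContDiffWithinAt ℝ ∞ (coordCurve d z γ) J t := by
  rw [← contMDiffWithinAt_iff_contDiffWithinAt]
  have h := contMDiffAt_extChartAt' (I := 𝓡∂ d) (n := ∞) (x := z) (x' := γ t)
    (by rwa [extChartAt_source] at hz)
  exact h.comp_contMDiffWithinAt t hγ

omit [IsManifold (𝓡∂ d) ∞ M] in
theorem eventually_mem_source {γ : ℝ → M} {J : Set ℝ} {t : ℝ} {z : M}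
    (hγ : ContinuousWithinAt γ J t) (hz : γ t ∈ (extChartAt (𝓡∂ d) z).source) :
    ∀ᶠ s in nhdsWithin t J, γ s ∈ (extChartAt (𝓡∂ d) z).source :=
  hγ.preimage_mem_nhdsWithin ((isOpen_extChartAt_source z).mem_nhds hz)

theorem hasDerivWithinAt_coordCurve {γ : ℝ → M} {J : Set ℝ} {t : ℝ} {z : M}
    (hγ : ContMDiffWithinAt 𝓘(ℝ, ℝ) (𝓡∂ d) ∞ γ J t) (hz : γ t ∈ (extChartAt (𝓡∂ d) z).source) :
    HasDerivWithinAt (coordCurve d z γ) (derivWithin (coordCurve d z γ) J t) J t :=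
  ((contDiffWithinAt_coordCurve hγ hz).differentiableWithinAt (by simp)).hasDerivWithinAt

theorem hasDerivWithinAt_derivWithin_coordCurve {γ : ℝ → M} {J : Set ℝ} {t : ℝ} {z : M}
    (hJ : UniqueDiffOn ℝ J) (ht : t ∈ J)
    (hγ : ContMDiffWithinAt 𝓘(ℝ, ℝ) (𝓡∂ d) ∞ γ J t) (hz : γ t ∈ (extChartAt (𝓡∂ d) z).source) :
    HasDerivWithinAt (derivWithin (coordCurve d z γ) J)
      (derivWithin (derivWithin (coordCurve d z γ) J) J t) J t := by
  have h := contDiffWithinAt_coordCurve hγ hz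
  have h1 : ContDiffWithinAt ℝ 1 (derivWithin (coordCurve d z γ) J) J t :=
    h.derivWithin hJ (by norm_cast) ht
  exact (h1.differentiableWithinAt (by simp)).hasDerivWithinAt

theorem velocity_eq {γ : ℝ → M} {J : Set ℝ} {t : ℝ} {z : M} (hJ : UniqueDiffWithinAt ℝ J t)
    (ht : t ∈ J)
    (hγ : ContMDiffWithinAt 𝓘(ℝ, ℝ) (𝓡∂ d) ∞ γ J t) (hz : γ t ∈ (extChartAt (𝓡∂ d) z).source) :
    velocity γ J t =
      chartSymmDeriv z (coordCurve d z γ t) (derivWithin (coordCurve d z γ) J t) := by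
  have hc := (hasDerivWithinAt_coordCurve hγ hz).hasFDerivWithinAt.hasMFDerivWithinAt
  have hs := (mdifferentiableWithinAt_extChartAt_symm (I := 𝓡∂ d)
    ((extChartAt (𝓡∂ d) z).map_source hz)).hasMFDerivWithinAt
  have h := HasMFDerivWithinAt.comp (u := range (𝓡∂ d)) t hs hc
    (fun s _ => coordCurve_mem_range z γ s)
  have heq : γ =ᶠ[nhdsWithin t J] (extChartAt (𝓡∂ d) z).symm ∘ coordCurve d z γ := by
    filter_upwards [eventually_mem_source hγ.continuousWithinAt hz] with s hs
    exact ((extChartAt (𝓡∂ d) z).left_inv hs).symm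
  have h2 := h.congr_of_eventuallyEq heq (heq.self_of_nhdsWithin ht)
  have h3 := h2.mfderivWithin hJ.uniqueMDiffWithinAt
  unfold velocity
  rw [h3]
  exact congrArg (chartSymmDeriv z (coordCurve d z γ t))
    (show ContinuousLinearMap.toSpanSingleton ℝ (derivWithin (coordCurve d z γ) J t) 1 = _ by simp)

theorem innerAt_velocity (g : Metric d M) {γ : ℝ → M} {J : Set ℝ} {t : ℝ} {z : M}
    (hJ : UniqueDiffWithinAt ℝ J t) (ht : t ∈ J)
    (hγ : ContMDiffWithinAt 𝓘(ℝ, ℝ) (𝓡∂ d) ∞ γ J t) (hz : γ t ∈ (extChartAt (𝓡∂ d) z).source) :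
    innerAt g (γ t) (velocity γ J t) (velocity γ J t) =
      ∑ i, ∑ j, gram g z (coordCurve d z γ t) i j * derivWithin (coordCurve d z γ) J t i *
        derivWithin (coordCurve d z γ) J t j := by
  rw [gram_dotProduct, ← velocity_eq hJ ht hγ hz]
  congr 2
  exact congrArg _ ((extChartAt (𝓡∂ d) z).left_inv hz).symm

end Smooth
end PotentialRay

namespace PotentialRay
variable {d : ℕ} [NeZero d] {M : Type*} [TopologicalSpace M]
  [ChartedSpace (EuclideanHalfSpace d) M] [IsManifold (𝓡∂ d) ∞ M]

/-! ### Newton's equation -/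

/-- The partial derivatives `∂ₗu` of a function on `M`, in the chart around `z`. -/
noncomputable def chartGrad (u : M → ℝ) (z : M) (y : Coord d) : Fin d → ℝ :=
  fun l => pd l (fun y' => u ((extChartAt (𝓡∂ d) z).symm y')) y

/-- The partial derivatives `∂ₗgᵢⱼ` of the metric, in the chart around `z`. -/
noncomputable def chartMetricDeriv (g : Metric d M) (z : M) (y : Coord d) :
    Fin d → Fin d → Fin d → ℝ :=
  fun l i j => pd l (fun y' => gram g z y' i j) y

/-- Newton's equation in vector form, `γ'' = - g⁻¹ (Γ(γ', γ') + dq)` with lowered indices. -/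
theorem isHGeodesicOn_iff (g : Metric d M) (q : M → ℝ) (γ : ℝ → M) (J : Set ℝ) :
    IsHGeodesicOn g q γ J ↔ ContMDiffOn 𝓘(ℝ, ℝ) (𝓡∂ d) ∞ γ J ∧
      ∀ t ∈ J, ∀ z : M, γ t ∈ (extChartAt (𝓡∂ d) z).source →
        (derivWithin (derivWithin (coordCurve d z γ) J) J t).ofLp =
          - ((gram g z (coordCurve d z γ t))⁻¹ *ᵥ
              (loweredChristoffel (chartMetricDeriv g z (coordCurve d z γ t))
                (derivWithin (coordCurve d z γ) J t).ofLp
              + chartGrad q z (coordCurve d z γ t))) := by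
  refine and_congr_right fun _ => forall₄_congr fun t _ z _ => ?_
  rw [funext_iff]
  refine forall_congr' fun k => ?_
  rw [christoffel_contract, gradComp_eq, Matrix.mulVec_add]
  simp only [Pi.neg_apply, Pi.add_apply]
  change _ + ((gram g z (coordCurve d z γ t))⁻¹ *ᵥ
      loweredChristoffel (chartMetricDeriv g z (coordCurve d z γ t)) _) k =
    - ((gram g z (coordCurve d z γ t))⁻¹ *ᵥ chartGrad q z (coordCurve d z γ t)) k ↔ _
  constructor <;> intro h <;> linarith

theorem gram_mulVec_inv (g : Metric d M) (z : M) {y : Coord d}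
    (hy : y ∈ (extChartAt (𝓡∂ d) z).target) (w : Fin d → ℝ) :
    gram g z y *ᵥ ((gram g z y)⁻¹ *ᵥ w) = w := by
  have h := (gram_posDef g z hy).det_pos.ne'
  rw [Matrix.mulVec_mulVec, Matrix.mul_nonsing_inv _ (isUnit_iff_ne_zero.2 h), Matrix.one_mulVec]

theorem gram_inv_mulVec (g : Metric d M) (z : M) {y : Coord d}
    (hy : y ∈ (extChartAt (𝓡∂ d) z).target) (w : Fin d → ℝ) :
    (gram g z y)⁻¹ *ᵥ (gram g z y *ᵥ w) = w := by
  have h := (gram_posDef g z hy).det_pos.ne'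
  rw [Matrix.mulVec_mulVec, Matrix.nonsing_inv_mul _ (isUnit_iff_ne_zero.2 h), Matrix.one_mulVec]

theorem gram_symm (g : Metric d M) (z : M) (y : Coord d) (i j : Fin d) :
    gram g z y i j = gram g z y j i := innerAt_symm g _ _ _

theorem hasDerivWithinAt_energy {g : Metric d M} {q : M → ℝ}
    (hq : ContMDiff (𝓡∂ d) 𝓘(ℝ, ℝ) ∞ q) {γ : ℝ → M} {J : Set ℝ}
    (hJ : UniqueDiffOn ℝ J) (hγ : IsHGeodesicOn g q γ J) {t : ℝ} (ht : t ∈ J) :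
    HasDerivWithinAt (fun s => energy g q (lift γ J s)) 0 J t := by
  obtain ⟨hs, he⟩ := (isHGeodesicOn_iff g q γ J).1 hγ
  set z := γ t with hz
  have hz' : γ t ∈ (extChartAt (𝓡∂ d) z).source := mem_extChartAt_source z
  have hy : coordCurve d z γ t ∈ (extChartAt (𝓡∂ d) z).target :=
    (extChartAt (𝓡∂ d) z).map_source hz'
  have hc := hasDerivWithinAt_coordCurve (hs t ht) hz'
  have hc' := hasDerivWithinAt_derivWithin_coordCurve hJ ht (hs t ht) hz'
  have heq := he t ht z hz'
  have hdA : ∀ i j, HasDerivWithinAt (fun s => gram g z (coordCurve d z γ s) i j) _ J t :=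
    fun i j => hasDerivWithinAt_comp_coordCurve (differentiableWithinAt_gram g z i j hy) hc
  have hdq := hasDerivWithinAt_comp_coordCurve (differentiableWithinAt_comp_symm hq z hy) hc
  have hdv : ∀ i, HasDerivWithinAt (fun s => derivWithin (coordCurve d z γ) J s i)
      (derivWithin (derivWithin (coordCurve d z γ) J) J t i) J t := fun i =>
    (EuclideanSpace.proj (𝕜 := ℝ) i).hasFDerivAt.comp_hasDerivWithinAt t hc'
  set A := gram g z (coordCurve d z γ t) with hA
  set v := derivWithin (coordCurve d z γ) J t with hv
  set a := derivWithin (derivWithin (coordCurve d z γ) J) J t with ha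
  set D := chartMetricDeriv g z (coordCurve d z γ t) with hD
  set Q := chartGrad q z (coordCurve d z γ t) with hQ
  -- The derivative of `½ gᵢⱼ vⁱ vʲ + q`; it vanishes because `½ ∂ₗgᵢⱼ vˡ vⁱ vʲ` is the contraction
  -- of `v` with the lowered Christoffel symbols.
  have hsum := ((HasDerivWithinAt.fun_sum fun i (_ : i ∈ Finset.univ) =>
    HasDerivWithinAt.fun_sum fun j (_ : j ∈ Finset.univ) =>
      ((hdA i j).mul (hdv i)).mul (hdv j)).const_mul (1 / 2)).add hdq
  have hval : (1 / 2) * ∑ i, ∑ j, (((∑ l, D l i j * v l) * v i + A i j * a i) * v j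
      + A i j * v i * a j) + ∑ l, Q l * v l = 0 := by
    have h1 : ∑ i, ∑ j, (∑ l, D l i j * v l) * v i * v j =
        ∑ l, ∑ i, ∑ j, D l i j * v l * v i * v j := by
      conv_rhs => rw [Finset.sum_comm]
      refine Finset.sum_congr rfl fun i _ => ?_
      conv_rhs => rw [Finset.sum_comm]
      refine Finset.sum_congr rfl fun j _ => ?_
      simp only [Finset.sum_mul]
    have h2 : ∑ i, ∑ j, A i j * a i * v j = v.ofLp ⬝ᵥ A *ᵥ a.ofLp := by
      simp only [dotProduct, Matrix.mulVec, Finset.mul_sum]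
      rw [Finset.sum_comm]
      refine Finset.sum_congr rfl fun i _ => Finset.sum_congr rfl fun j _ => ?_
      rw [hA, gram_symm]; ring
    have h3 : ∑ i, ∑ j, A i j * v i * a j = v.ofLp ⬝ᵥ A *ᵥ a.ofLp := by
      simp only [dotProduct, Matrix.mulVec, Finset.mul_sum]
      exact Finset.sum_congr rfl fun i _ => Finset.sum_congr rfl fun j _ => by ring
    have h4 : A *ᵥ a.ofLp = -(loweredChristoffel D v.ofLp + Q) := by
      rw [heq, Matrix.mulVec_neg, gram_mulVec_inv g z hy]
    have h5 := dotProduct_loweredChristoffel D v.ofLp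
    have h6 : ∑ i, ∑ j, (((∑ l, D l i j * v l) * v i + A i j * a i) * v j
        + A i j * v i * a j) = ∑ i, ∑ j, (∑ l, D l i j * v l) * v i * v j
        + ∑ i, ∑ j, A i j * a i * v j + ∑ i, ∑ j, A i j * v i * a j := by
      simp only [← Finset.sum_add_distrib]
      exact Finset.sum_congr rfl fun i _ => Finset.sum_congr rfl fun j _ => by ring
    rw [h6, h1, h2, h3, h4, dotProduct_neg, dotProduct_add, h5]
    have h7 : v.ofLp ⬝ᵥ Q = ∑ l, Q l * v l := by
      simp only [dotProduct]; exact Finset.sum_congr rfl fun i _ => by ring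
    rw [h7]; ring
  refine (hsum.congr_deriv hval).congr_of_eventuallyEq_of_mem ?_ ht
  filter_upwards [eventually_mem_source (hs t ht).continuousWithinAt hz', self_mem_nhdsWithin]
    with s hs1 hs2
  have h1 := innerAt_velocity g (hJ s hs2) hs2 (hs s hs2) hs1
  have h2 : energy g q (lift γ J s) =
    (1 / 2) * innerAt g (γ s) (velocity γ J s) (velocity γ J s) + q (γ s) := rfl
  rw [h2, h1]
  simp only [coordCurve, Pi.add_apply, Pi.mul_apply]
  rw [(extChartAt (𝓡∂ d) z).left_inv hs1]

/-- Conservation of energy. -/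
theorem energy_lift_eq {g : Metric d M} {q : M → ℝ}
    (hq : ContMDiff (𝓡∂ d) 𝓘(ℝ, ℝ) ∞ q) {γ : ℝ → M} {T : ℝ} (hT : 0 < T)
    (hγ : IsHGeodesicOn g q γ (Icc 0 T)) {t : ℝ} (ht : t ∈ Icc 0 T) :
    energy g q (lift γ (Icc 0 T) t) = energy g q (lift γ (Icc 0 T) 0) := by
  have hJ := uniqueDiffOn_Icc hT
  have h := fun s (hs : s ∈ Icc 0 T) => hasDerivWithinAt_energy hq hJ hγ hs
  exact constant_of_derivWithin_zero (fun s hs => (h s hs).differentiableWithinAt)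
    (fun s hs => (h s (Ico_subset_Icc_self hs)).derivWithin (hJ s (Ico_subset_Icc_self hs))) t ht

/-! ### Change of parameter -/

omit [IsManifold (𝓡∂ d) ∞ M] in
theorem contMDiffOn_comp_param {γ : ℝ → M} {J J' : Set ℝ} {r : ℝ → ℝ}
    (hγ : ContMDiffOn 𝓘(ℝ, ℝ) (𝓡∂ d) ∞ γ J) (hr : ContDiffOn ℝ ∞ r J') (hm : MapsTo r J' J) :
    ContMDiffOn 𝓘(ℝ, ℝ) (𝓡∂ d) ∞ (γ ∘ r) J' :=
  hγ.comp hr.contMDiffOn hm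

omit [IsManifold (𝓡∂ d) ∞ M] in
theorem velocity_comp {γ : ℝ → M} {J J' : Set ℝ} {r : ℝ → ℝ} {s r' : ℝ}
    (hJ' : UniqueDiffWithinAt ℝ J' s)
    (hγ : MDifferentiableWithinAt 𝓘(ℝ, ℝ) (𝓡∂ d) γ J (r s)) (hr : HasDerivWithinAt r r' J' s)
    (hm : MapsTo r J' J) :
    (velocity (γ ∘ r) J' s : Coord d) = r' • velocity γ J (r s) := by
  have h := HasMFDerivWithinAt.comp (I' := 𝓘(ℝ, ℝ)) (u := J) s hγ.hasMFDerivWithinAt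
    hr.hasFDerivWithinAt.hasMFDerivWithinAt hm
  have h3 := h.mfderivWithin hJ'.uniqueMDiffWithinAt
  unfold velocity
  rw [h3]
  have h4 : ContinuousLinearMap.toSpanSingleton ℝ r' (1 : ℝ) = r' • (1 : ℝ) := by simp
  have h5 := map_smul (show ℝ →L[ℝ] Coord d from mfderivWithin 𝓘(ℝ, ℝ) (𝓡∂ d) γ J (r s)) r' 1
  exact (congrArg (show ℝ →L[ℝ] Coord d from mfderivWithin 𝓘(ℝ, ℝ) (𝓡∂ d) γ J (r s)) h4).trans h5

/-- First and second derivatives of a reparametrized curve, in coordinates. -/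
theorem derivWithin_coordCurve_comp {γ : ℝ → M} {J J' : Set ℝ} {r r' : ℝ → ℝ} {s r'' : ℝ} {z : M}
    (hJ : UniqueDiffOn ℝ J) (hJ' : UniqueDiffOn ℝ J')
    (hγ : ContMDiffOn 𝓘(ℝ, ℝ) (𝓡∂ d) ∞ γ J)
    (hr : ∀ s ∈ J', HasDerivWithinAt r (r' s) J' s) (hr' : HasDerivWithinAt r' r'' J' s)
    (hm : MapsTo r J' J) (hs : s ∈ J') (hz : γ (r s) ∈ (extChartAt (𝓡∂ d) z).source) :
    derivWithin (coordCurve d z (γ ∘ r)) J' s = r' s • derivWithin (coordCurve d z γ) J (r s) ∧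
    derivWithin (derivWithin (coordCurve d z (γ ∘ r)) J') J' s =
      r'' • derivWithin (coordCurve d z γ) J (r s)
        + r' s ^ 2 • derivWithin (derivWithin (coordCurve d z γ) J) J (r s) := by
  have h1 : ∀ s ∈ J', γ (r s) ∈ (extChartAt (𝓡∂ d) z).source →
      derivWithin (coordCurve d z (γ ∘ r)) J' s =
        r' s • derivWithin (coordCurve d z γ) J (r s) := by
    intro s hs hz
    have := (hasDerivWithinAt_coordCurve (hγ _ (hm hs)) hz).scomp s (hr s hs) hm
    exact this.derivWithin (hJ' s hs)
  refine ⟨h1 s hs hz, ?_⟩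
  have h2 := (hasDerivWithinAt_derivWithin_coordCurve hJ (hm hs) (hγ _ (hm hs)) hz).scomp s
    (hr s hs) hm
  have h3 := hr'.fun_smul h2
  have h4 : derivWithin (coordCurve d z (γ ∘ r)) J' =ᶠ[nhdsWithin s J']
      fun s => r' s • (derivWithin (coordCurve d z γ) J ∘ r) s := by
    have hcont : ContinuousWithinAt (γ ∘ r) J' s :=
      (hγ _ (hm hs)).continuousWithinAt.comp (hr s hs).continuousWithinAt hm
    filter_upwards [eventually_mem_source hcont hz, self_mem_nhdsWithin] with u hu1 hu2
    exact h1 u hu2 hu1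
  rw [(h3.congr_of_eventuallyEq_of_mem h4 hs).derivWithin (hJ' s hs)]
  simp only [Function.comp]
  rw [smul_smul, add_comm, sq]

/-- Restrictions of solutions of Newton's equation are solutions. -/
theorem IsHGeodesicOn.mono {g : Metric d M} {q : M → ℝ} {γ : ℝ → M} {J J' : Set ℝ}
    (hγ : IsHGeodesicOn g q γ J) (hJ : UniqueDiffOn ℝ J) (hJ' : UniqueDiffOn ℝ J') (h : J' ⊆ J) :
    IsHGeodesicOn g q γ J' := by
  refine ⟨hγ.1.mono h, fun t ht z hz k => ?_⟩
  obtain ⟨h1, h2⟩ := derivWithin_coordCurve_comp (r := id) (r' := fun _ => 1) (r'' := 0) hJ hJ' hγ.1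
    (fun s _ => hasDerivWithinAt_id s J') (hasDerivWithinAt_const t J' 1) h ht hz
  have := hγ.2 t (h ht) z hz k
  simp only [Function.comp_id, id, one_smul, zero_smul, zero_add, one_pow] at h1 h2
  rw [h1, h2]
  exact this

/-- Affine reparametrizations of geodesics are geodesics. -/
theorem IsGeodesicOn.comp_mul {g : Metric d M} {γ : ℝ → M} {J J' : Set ℝ} {c : ℝ}
    (hγ : IsGeodesicOn g γ J) (hJ : UniqueDiffOn ℝ J) (hJ' : UniqueDiffOn ℝ J')
    (h : MapsTo (fun s => c * s) J' J) :
    IsGeodesicOn g (γ ∘ fun s => c * s) J' := by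
  have hd : ∀ s, HasDerivWithinAt (fun s => c * s) c J' s := fun s => by
    simpa using (hasDerivWithinAt_id s J').const_mul c
  obtain ⟨hs, he⟩ := (isHGeodesicOn_iff g _ γ J).1 hγ
  refine (isHGeodesicOn_iff g _ _ J').2
    ⟨contMDiffOn_comp_param hs (contDiff_const.mul contDiff_id).contDiffOn h, fun t ht z hz => ?_⟩
  obtain ⟨h1, h2⟩ := derivWithin_coordCurve_comp (r := fun s => c * s) (r' := fun _ => c)
    (r'' := 0) hJ hJ' hγ.1 (fun s _ => hd s) (hasDerivWithinAt_const t J' c) h ht hz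
  have h3 := he _ (h ht) z hz
  have h0 : ∀ y : Coord d, chartGrad (fun _ : M => (0 : ℝ)) z y = 0 := fun y => by
    ext l; simp [chartGrad, pd]
  have hcc : coordCurve d z (γ ∘ fun s => c * s) t = coordCurve d z γ (c * t) := rfl
  rw [h0, add_zero] at h3 ⊢
  rw [h1, h2, hcc, zero_smul, zero_add, WithLp.ofLp_smul, WithLp.ofLp_smul, h3,
    loweredChristoffel_smul, Matrix.mulVec_smul, smul_neg]

theorem chartMetricDeriv_conformal {g₁ g₂ : Metric d M} {κ : M → ℝ}
    (hκ : ContMDiff (𝓡∂ d) 𝓘(ℝ, ℝ) ∞ κ)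
    (hg : ∀ x v w, innerAt g₂ x v w = κ x * innerAt g₁ x v w)
    (z : M) {y : Coord d} (hy : y ∈ (extChartAt (𝓡∂ d) z).target) :
    chartMetricDeriv g₂ z y = fun l i j =>
      κ ((extChartAt (𝓡∂ d) z).symm y) * chartMetricDeriv g₁ z y l i j
        + chartGrad κ z y l * gram g₁ z y i j := by
  ext l i j
  have h1 : (fun y' => gram g₂ z y' i j) =
      fun y' => κ ((extChartAt (𝓡∂ d) z).symm y') * gram g₁ z y' i j := by
    ext y'; simp only [gram_apply, hg]
  simp only [chartMetricDeriv, chartGrad, pd]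
  rw [h1, fderivWithin_fun_mul (uniqueDiffWithinAt_range hy)
    (differentiableWithinAt_comp_symm hκ z hy) (differentiableWithinAt_gram g₁ z i j hy)]
  simp
  ring

theorem gram_conformal {g₁ g₂ : Metric d M} {κ : M → ℝ}
    (hg : ∀ x v w, innerAt g₂ x v w = κ x * innerAt g₁ x v w) (z : M) (y : Coord d) :
    gram g₂ z y = κ ((extChartAt (𝓡∂ d) z).symm y) • gram g₁ z y := by
  ext i j; simp only [gram_apply, hg, Matrix.smul_apply, smul_eq_mul]

theorem gram_inv_conformal {g₁ g₂ : Metric d M} {κ : M → ℝ} (hpos : ∀ x, 0 < κ x)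
    (hg : ∀ x v w, innerAt g₂ x v w = κ x * innerAt g₁ x v w) (z : M) {y : Coord d}
    (hy : y ∈ (extChartAt (𝓡∂ d) z).target) :
    (gram g₂ z y)⁻¹ = (κ ((extChartAt (𝓡∂ d) z).symm y))⁻¹ • (gram g₁ z y)⁻¹ := by
  have h := (gram_posDef g₁ z hy).det_pos.ne'
  rw [gram_conformal hg]
  have := Matrix.inv_smul' (gram g₁ z y) (Units.mk0 _ (hpos ((extChartAt (𝓡∂ d) z).symm y)).ne')
    (isUnit_iff_ne_zero.2 h)
  simpa [Units.smul_def] using this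

/-- The conformal change of `Γᵏᵢⱼ vⁱ vʲ`. -/
theorem christoffel_conformal {g₁ g₂ : Metric d M} {κ : M → ℝ}
    (hκ : ContMDiff (𝓡∂ d) 𝓘(ℝ, ℝ) ∞ κ) (hpos : ∀ x, 0 < κ x)
    (hg : ∀ x v w, innerAt g₂ x v w = κ x * innerAt g₁ x v w)
    (z : M) {y : Coord d} (hy : y ∈ (extChartAt (𝓡∂ d) z).target) (v : Fin d → ℝ) :
    (gram g₂ z y)⁻¹ *ᵥ loweredChristoffel (chartMetricDeriv g₂ z y) v =
      (gram g₁ z y)⁻¹ *ᵥ loweredChristoffel (chartMetricDeriv g₁ z y) v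
      + (κ ((extChartAt (𝓡∂ d) z).symm y))⁻¹ • ((chartGrad κ z y ⬝ᵥ v) • v
        - (1 / 2 * (v ⬝ᵥ gram g₁ z y *ᵥ v)) • ((gram g₁ z y)⁻¹ *ᵥ chartGrad κ z y)) := by
  have hA : (gram g₁ z y).IsSymm := by ext i j; exact gram_symm g₁ z y j i
  rw [gram_inv_conformal hpos hg z hy, chartMetricDeriv_conformal hκ hg z hy,
    loweredChristoffel_conformal _ _ hA, Matrix.smul_mulVec, Matrix.mulVec_sub, Matrix.mulVec_add,
    Matrix.mulVec_smul, Matrix.mulVec_smul, Matrix.mulVec_smul, gram_inv_mulVec g₁ z hy,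
    add_sub_assoc, smul_add, smul_smul, inv_mul_cancel₀ (hpos _).ne', one_smul]

theorem fderivWithin_const_sub_mul {E : Type*} [NormedAddCommGroup E] [NormedSpace ℝ E]
    {a b : E → ℝ} {E₁ E₂ : ℝ} {s : Set E} {y v : E} (hs : UniqueDiffWithinAt ℝ s y)
    (ha : DifferentiableWithinAt ℝ a s y) (hb : DifferentiableWithinAt ℝ b s y) :
    fderivWithin ℝ (fun y => E₁ - a y * (E₂ - b y)) s y v =
      a y * fderivWithin ℝ b s y v - (E₂ - b y) * fderivWithin ℝ a s y v := by
  rw [fderivWithin_const_sub hs, fderivWithin_fun_mul hs ha (hb.const_sub _),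
    fderivWithin_const_sub hs]
  simp
  ring

/-- **Maupertuis' principle**. The solutions of energy `E₁` of the system `(g₁, q₁)` become
solutions of energy `E₂` of `(g₂, q₂)`, where `g₂ = κ g₁` and `E₁ - q₁ = κ (E₂ - q₂)`, when the
parameter is changed according to `dr/ds = 1/κ`. -/
theorem IsHGeodesicOn.maupertuis {g₁ g₂ : Metric d M} {κ q₁ q₂ : M → ℝ} {E₁ E₂ : ℝ}
    (hκ : ContMDiff (𝓡∂ d) 𝓘(ℝ, ℝ) ∞ κ) (hpos : ∀ x, 0 < κ x)
    (hg : ∀ x v w, innerAt g₂ x v w = κ x * innerAt g₁ x v w)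
    (hq₂ : ContMDiff (𝓡∂ d) 𝓘(ℝ, ℝ) ∞ q₂)
    (hE : ∀ x, E₁ - q₁ x = κ x * (E₂ - q₂ x))
    {γ : ℝ → M} {J J' : Set ℝ} {r : ℝ → ℝ} (hJ : UniqueDiffOn ℝ J) (hJ' : UniqueDiffOn ℝ J')
    (hγ : IsHGeodesicOn g₁ q₁ γ J) (hen : ∀ t ∈ J, energy g₁ q₁ (lift γ J t) = E₁)
    (hrs : ContDiffOn ℝ ∞ r J') (hm : MapsTo r J' J)
    (hr : ∀ s ∈ J', HasDerivWithinAt r (κ (γ (r s)))⁻¹ J' s) :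
    IsHGeodesicOn g₂ q₂ (γ ∘ r) J' := by
  obtain ⟨hs, he⟩ := (isHGeodesicOn_iff g₁ q₁ γ J).1 hγ
  refine (isHGeodesicOn_iff g₂ q₂ _ J').2 ⟨contMDiffOn_comp_param hs hrs hm, fun s hsJ z hz => ?_⟩
  have ht := hm hsJ
  have hz1 : γ (r s) ∈ (extChartAt (𝓡∂ d) z).source := hz
  have hy : coordCurve d z γ (r s) ∈ (extChartAt (𝓡∂ d) z).target :=
    (extChartAt (𝓡∂ d) z).map_source hz
  have hsymm : (extChartAt (𝓡∂ d) z).symm (coordCurve d z γ (r s)) = γ (r s) :=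
    (extChartAt (𝓡∂ d) z).left_inv hz1
  have hc := hasDerivWithinAt_coordCurve (hs _ ht) hz1
  have hdκ := hasDerivWithinAt_comp_coordCurve (differentiableWithinAt_comp_symm hκ z hy) hc
  have heq := he _ ht z hz1
  have hinner := innerAt_velocity g₁ (hJ _ ht) ht (hs _ ht) hz1
  have hcc : coordCurve d z (γ ∘ r) s = coordCurve d z γ (r s) := rfl
  set y := coordCurve d z γ (r s) with hy_def
  set v := derivWithin (coordCurve d z γ) J (r s) with hv
  set a := derivWithin (derivWithin (coordCurve d z γ) J) J (r s) with ha
  set K := chartGrad κ z y with hK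
  set k := κ (γ (r s)) with hk
  have hk0 : k ≠ 0 := (hpos _).ne'
  have hdr : HasDerivWithinAt (fun s => (κ (γ (r s)))⁻¹) (-(k⁻¹ * (K ⬝ᵥ v.ofLp)) / k ^ 2) J' s := by
    have h1 := (hdκ.comp s (hr s hsJ) hm)
    have h2 : HasDerivWithinAt (fun s => κ (γ (r s))) (k⁻¹ * (K ⬝ᵥ v.ofLp)) J' s := by
      refine (h1.congr_deriv (mul_comm _ _)).congr_of_eventuallyEq_of_mem ?_ hsJ
      have hcont : ContinuousWithinAt (γ ∘ r) J' s :=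
        (hs _ ht).continuousWithinAt.comp (hr s hsJ).continuousWithinAt hm
      filter_upwards [eventually_mem_source hcont hz] with u hu
      exact congrArg κ ((extChartAt (𝓡∂ d) z).left_inv hu).symm
    exact h2.fun_inv hk0
  obtain ⟨h1, h2⟩ := derivWithin_coordCurve_comp (r' := fun s => (κ (γ (r s)))⁻¹)
    hJ hJ' hs hr hdr hm hsJ hz1
  have hspeed : v.ofLp ⬝ᵥ gram g₁ z y *ᵥ v.ofLp = 2 * (k * (E₂ - q₂ (γ (r s)))) := by
    have h3 : (1 / 2) * innerAt g₁ (γ (r s)) (velocity γ J (r s)) (velocity γ J (r s))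
        + q₁ (γ (r s)) = E₁ := hen _ ht
    rw [hinner] at h3
    rw [hk, ← hE, ← h3]
    have h4 : v.ofLp ⬝ᵥ gram g₁ z y *ᵥ v.ofLp = ∑ i, ∑ j, gram g₁ z y i j * v i * v j := by
      simp only [dotProduct, Matrix.mulVec, Finset.mul_sum]
      exact Finset.sum_congr rfl fun i _ => Finset.sum_congr rfl fun j _ => by ring
    rw [h4]
    ring
  have hQ : chartGrad q₁ z y = k • chartGrad q₂ z y - (E₂ - q₂ (γ (r s))) • K := by
    ext l
    have h3 : (fun y' => q₁ ((extChartAt (𝓡∂ d) z).symm y')) = fun y' => E₁ -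
        κ ((extChartAt (𝓡∂ d) z).symm y') * (E₂ - q₂ ((extChartAt (𝓡∂ d) z).symm y')) := by
      ext y'; linarith [hE ((extChartAt (𝓡∂ d) z).symm y')]
    have hu := uniqueDiffWithinAt_range hy
    have hdk := differentiableWithinAt_comp_symm hκ z hy
    have hdq := differentiableWithinAt_comp_symm hq₂ z hy
    simp only [hK, chartGrad, pd, Pi.sub_apply, Pi.smul_apply, smul_eq_mul]
    rw [h3, fderivWithin_const_sub_mul hu hdk hdq]
    simp only [hsymm, hk]
  rw [← hv, ← hk] at h1
  rw [← hv, ← ha, ← hk] at h2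
  rw [h1, h2, hcc, WithLp.ofLp_add, WithLp.ofLp_smul, WithLp.ofLp_smul, WithLp.ofLp_smul, heq,
    loweredChristoffel_smul, Matrix.mulVec_add, Matrix.mulVec_add, Matrix.mulVec_smul,
    christoffel_conformal hκ hpos hg z hy, gram_inv_conformal hpos hg z hy, hsymm, ← hk, ← hK,
    hspeed, hQ,
    Matrix.smul_mulVec, Matrix.mulVec_sub, Matrix.mulVec_smul, Matrix.mulVec_smul]
  ext l
  simp only [Pi.add_apply, Pi.neg_apply, Pi.smul_apply, Pi.sub_apply, smul_eq_mul]
  field_simp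
  ring

end PotentialRay

namespace PotentialRay

/-! ### A change of parameter with prescribed speed -/

/-- The primitive of a positive smooth function on `[0, T]` has a smooth increasing inverse. -/
theorem exists_inverse_of_integral {T : ℝ} (hT : 0 < T) {h : ℝ → ℝ}
    (hh : ContDiffOn ℝ ∞ h (Icc 0 T)) (hpos : ∀ t ∈ Icc 0 T, 0 < h t) :
    ∃ r : ℝ → ℝ, StrictMonoOn (fun t => ∫ u in (0 : ℝ)..t, h u) (Icc 0 T) ∧
      StrictMonoOn r (Icc 0 (∫ u in (0 : ℝ)..T, h u)) ∧
      BijOn (fun t => ∫ u in (0 : ℝ)..t, h u) (Icc 0 T) (Icc 0 (∫ u in (0 : ℝ)..T, h u)) ∧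
      BijOn r (Icc 0 (∫ u in (0 : ℝ)..T, h u)) (Icc 0 T) ∧
      ContDiffOn ℝ ∞ r (Icc 0 (∫ u in (0 : ℝ)..T, h u)) ∧
      (∀ t ∈ Icc 0 T, r (∫ u in (0 : ℝ)..t, h u) = t) ∧
      (∀ t ∈ Icc 0 T, HasDerivWithinAt (fun t => ∫ u in (0 : ℝ)..t, h u) (h t) (Icc 0 T) t) ∧
      ∀ s ∈ Icc 0 (∫ u in (0 : ℝ)..T, h u),
        HasDerivWithinAt r (h (r s))⁻¹ (Icc 0 (∫ u in (0 : ℝ)..T, h u)) s := by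
  set S := ∫ u in (0 : ℝ)..T, h u with hS
  -- Extended by constants outside `[0, T]`, the speed `h` has a global primitive, which is an
  -- increasing homeomorphism of the line.
  set k : ℝ → ℝ := IccExtend hT.le ((Icc 0 T).domRestrict h) with hk
  have hkc : Continuous k := hh.continuousOn.domRestrict.Icc_extend'
  have hkh : ∀ t ∈ Icc 0 T, k t = h t := fun t ht => IccExtend_of_mem hT.le _ ht
  obtain ⟨m, hm0, hm⟩ : ∃ m > 0, ∀ t, m ≤ k t := by
    obtain ⟨t₀, ht₀, hmin⟩ := isCompact_Icc.exists_isMinOn (nonempty_Icc.2 hT.le) hh.continuousOn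
    refine ⟨h t₀, hpos t₀ ht₀, fun t => ?_⟩
    exact hmin (projIcc 0 T hT.le t).2
  set σ : ℝ → ℝ := fun t => ∫ u in (0 : ℝ)..t, k u with hσ
  have hσd : ∀ t, HasDerivAt σ (k t) t := fun t => (hkc.integral_hasStrictDerivAt 0 t).hasDerivAt
  have hσm : StrictMono σ := strictMono_of_deriv_pos fun t => by
    rw [(hσd t).deriv]; exact hm0.trans_le (hm t)
  have hσc : Continuous σ := continuous_iff_continuousAt.2 fun t => (hσd t).continuousAt
  have hσ0 : σ 0 = 0 := by simp [hσ]
  have hmono : Monotone fun t => σ t - m * t := by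
    refine monotone_of_deriv_nonneg (fun t => ?_) fun t => ?_
    · exact ((hσd t).sub ((hasDerivAt_id t).const_mul m)).differentiableAt
    · have := ((hσd t).sub ((hasDerivAt_id t).const_mul m)).deriv
      rw [show (fun t => σ t - m * t) = σ - fun t => m * id t from rfl, this]
      linarith [hm t]
  have hsurj : Function.Surjective σ := by
    refine hσc.surjective ?_ ?_
    · refine Filter.tendsto_atTop_mono' _ ?_ (Filter.tendsto_id.const_mul_atTop hm0)
      filter_upwards [Filter.eventually_ge_atTop 0] with t ht
      have := hmono ht
      simp only [hσ0, mul_zero, sub_zero, id] at this ⊢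
      linarith
    · refine Filter.tendsto_atBot_mono' _ ?_ (Filter.tendsto_id.const_mul_atBot hm0)
      filter_upwards [Filter.eventually_le_atBot 0] with t ht
      have := hmono ht
      simp only [hσ0, mul_zero, sub_zero, id] at this ⊢
      linarith
  set e : ℝ ≃o ℝ := hσm.orderIsoOfSurjective σ hsurj with he
  have hes : ∀ t, e.symm (σ t) = t := fun t => e.symm_apply_apply t
  have hse : ∀ s, σ (e.symm s) = s := fun s => e.apply_symm_apply s
  have hint : ∀ t ∈ Icc 0 T, ∫ u in (0 : ℝ)..t, h u = σ t := fun t ht =>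
    intervalIntegral.integral_congr fun u hu => by
      rw [uIcc_of_le ht.1] at hu
      exact (hkh u ⟨hu.1, hu.2.trans ht.2⟩).symm
  have hST : S = σ T := hint T (right_mem_Icc.2 hT.le)
  have hd : ∀ s, HasDerivAt e.symm (k (e.symm s))⁻¹ s := fun s =>
    HasDerivAt.of_local_left_inverse (e.toHomeomorph.symm.continuous.continuousAt) (hσd _)
      (hm0.trans_le (hm _)).ne' (Filter.Eventually.of_forall hse)
  have hbij : BijOn e.symm (Icc 0 S) (Icc 0 T) := by
    refine ⟨fun s hs => ?_, e.symm.injective.injOn, fun t ht => ⟨σ t, ?_, hes t⟩⟩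
    · constructor
      · rw [← hσm.le_iff_le, hse, hσ0]; exact hs.1
      · rw [← hσm.le_iff_le, hse, ← hST]; exact hs.2
    · rw [← hσ0, hST]; exact ⟨hσm.monotone ht.1, hσm.monotone ht.2⟩
  have hbij' : BijOn (fun t => ∫ u in (0 : ℝ)..t, h u) (Icc 0 T) (Icc 0 S) := by
    refine BijOn.congr (f₁ := σ) ?_ fun t ht => (hint t ht).symm
    refine ⟨fun t ht => ?_, hσm.injective.injOn, fun s hs => ⟨e.symm s, hbij.mapsTo hs, hse s⟩⟩
    rw [← hσ0, hST]; exact ⟨hσm.monotone ht.1, hσm.monotone ht.2⟩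
  have hS0 : 0 < S := by rw [hST, ← hσ0]; exact hσm hT
  have hdr : ∀ s ∈ Icc 0 S, HasDerivWithinAt e.symm (h (e.symm s))⁻¹ (Icc 0 S) s := fun s hs => by
    rw [← hkh _ (hbij.mapsTo hs)]; exact (hd s).hasDerivWithinAt
  refine ⟨e.symm, ?_, e.symm.strictMono.strictMonoOn _, hbij', hbij, ?_,
    fun t ht => ?_, fun t ht => ?_, hdr⟩
  · exact (hσm.strictMonoOn _).congr fun t ht => (hint t ht).symm
  · rw [contDiffOn_infty]
    intro n
    -- The equation `r' = 1 / h(r)` raises the order of differentiability step by step.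
    induction n with
    | zero => exact contDiffOn_zero.2 fun s hs => (hdr s hs).continuousWithinAt
    | succ n ih =>
      push_cast
      rw [contDiffOn_succ_iff_derivWithin (uniqueDiffOn_Icc hS0)]
      refine ⟨fun s hs => (hdr s hs).differentiableWithinAt, by simp, ?_⟩
      have : ContDiffOn ℝ n (fun s => (h (e.symm s))⁻¹) (Icc 0 S) :=
        ((hh.of_le (by exact_mod_cast le_top)).comp ih hbij.mapsTo).inv
          fun s hs => (hpos _ (hbij.mapsTo hs)).ne'
      exact this.congr fun s hs => (hdr s hs).derivWithin (uniqueDiffOn_Icc hS0 s hs)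
  · rw [hint t ht, hes]
  · rw [← hkh t ht]
    exact (hσd t).hasDerivWithinAt.congr hint (hint t ht)

/-! ### Integrals depending on a parameter -/

section Parametric
variable {E : Type*} [NormedAddCommGroup E]

theorem continuousOn_intervalIntegral {F : Type*} [NormedAddCommGroup F] [NormedSpace ℝ F]
    {K : Set E} (hK : IsCompact K) {f : ℝ × E → F} (hf : ContinuousOn f (Icc 0 1 ×ˢ K)) :
    ContinuousOn (fun u => ∫ a in (0 : ℝ)..1, f (a, u)) K := by
  obtain ⟨C, hC⟩ := (isCompact_Icc.prod hK).exists_bound_of_continuousOn hf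
  intro u hu
  have hsl : ∀ u ∈ K, ContinuousOn (fun a => f (a, u)) (Icc 0 1) := fun u hu =>
    hf.comp (by fun_prop) fun a ha => ⟨ha, hu⟩
  refine intervalIntegral.continuousWithinAt_of_dominated_interval (bound := fun _ => C) ?_ ?_ ?_ ?_
  · filter_upwards [self_mem_nhdsWithin] with v hv
    rw [uIoc_of_le zero_le_one]
    exact ((hsl v hv).mono Ioc_subset_Icc_self).aestronglyMeasurable measurableSet_Ioc
  · filter_upwards [self_mem_nhdsWithin] with v hv
    refine Filter.Eventually.of_forall fun a ha => hC _ ⟨?_, hv⟩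
    rw [uIoc_of_le zero_le_one] at ha
    exact Ioc_subset_Icc_self ha
  · simp
  · refine Filter.Eventually.of_forall fun a ha => ?_
    rw [uIoc_of_le zero_le_one] at ha
    exact (hf (a, u) ⟨Ioc_subset_Icc_self ha, hu⟩).comp (by fun_prop)
      fun v hv => ⟨Ioc_subset_Icc_self ha, hv⟩

/-- Differentiation under the integral sign, within a compact convex set of parameters. -/
theorem hasFDerivWithinAt_intervalIntegral [NormedSpace ℝ E] {F : Type*} [NormedAddCommGroup F]
    [NormedSpace ℝ F] {K : Set E} (hK : IsCompact K) (hKc : Convex ℝ K)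
    {f : ℝ × E → F} {f' : ℝ × E → E →L[ℝ] F} (hf : ContinuousOn f (Icc 0 1 ×ˢ K))
    (hf' : ContinuousOn f' (Icc 0 1 ×ˢ K))
    (hd : ∀ a ∈ Icc (0 : ℝ) 1, ∀ u ∈ K, HasFDerivWithinAt (fun u => f (a, u)) (f' (a, u)) K u)
    {u : E} (hu : u ∈ K) :
    HasFDerivWithinAt (fun u => ∫ a in (0 : ℝ)..1, f (a, u))
      (∫ a in (0 : ℝ)..1, f' (a, u)) K u := by
  have hint : ∀ v ∈ K, IntervalIntegrable (fun a => f (a, v)) volume 0 1 := fun v hv => by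
    refine ContinuousOn.intervalIntegrable ?_
    rw [uIcc_of_le zero_le_one]
    exact hf.comp (by fun_prop) fun a ha => ⟨ha, hv⟩
  have hint' : IntervalIntegrable (fun a => f' (a, u)) volume 0 1 := by
    refine ContinuousOn.intervalIntegrable ?_
    rw [uIcc_of_le zero_le_one]
    exact hf'.comp (by fun_prop) fun a ha => ⟨ha, hu⟩
  rw [hasFDerivWithinAt_iff_isLittleO, Asymptotics.isLittleO_iff]
  intro ε hε
  obtain ⟨δ, hδ, hunif⟩ := Metric.uniformContinuousOn_iff.1
    ((isCompact_Icc.prod hK).uniformContinuousOn_of_continuous hf') ε hε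
  filter_upwards [self_mem_nhdsWithin, inter_mem_nhdsWithin K (Metric.ball_mem_nhds u hδ)]
    with v hv hvb
  have hpt : ∀ a ∈ uIoc (0 : ℝ) 1, ‖f (a, v) - f (a, u) - f' (a, u) (v - u)‖ ≤ ε * ‖v - u‖ := by
    intro a ha
    rw [uIoc_of_le zero_le_one] at ha
    have ha' := Ioc_subset_Icc_self ha
    refine (hKc.inter (convex_ball u δ)).norm_image_sub_le_of_norm_hasFDerivWithin_le'
      (f := fun u => f (a, u)) (f' := fun u => f' (a, u)) (s := K ∩ Metric.ball u δ)
      (fun w hw => (hd a ha' w hw.1).mono inter_subset_left) (fun w hw => ?_)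
      ⟨hu, Metric.mem_ball_self hδ⟩ hvb
    rw [← dist_eq_norm]
    refine (hunif (a, w) ⟨ha', hw.1⟩ (a, u) ⟨ha', hu⟩ ?_).le
    rw [Prod.dist_eq]
    simpa [hδ] using hw.2
  have := intervalIntegral.norm_integral_le_of_norm_le_const hpt
  have hcl : ∫ a in (0 : ℝ)..1, (f (a, v) - f (a, u) - f' (a, u) (v - u)) =
      (∫ a in (0 : ℝ)..1, f (a, v)) - (∫ a in (0 : ℝ)..1, f (a, u))
        - (∫ a in (0 : ℝ)..1, f' (a, u)) (v - u) := by
    have hi : IntervalIntegrable (fun a => f' (a, u) (v - u)) volume 0 1 := by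
      refine ContinuousOn.intervalIntegrable ?_
      rw [uIcc_of_le zero_le_one]
      exact (hf'.comp (by fun_prop) fun a ha => ⟨ha, hu⟩).clm_apply continuousOn_const
    rw [intervalIntegral.integral_sub ((hint v hv).sub (hint u hu)) hi,
      intervalIntegral.integral_sub (hint v hv) (hint u hu),
      ContinuousLinearMap.intervalIntegral_apply hint']
  rw [hcl] at this
  simpa using this

universe u in
/-- Integrals of smooth functions depend smoothly on a parameter in a compact convex set. The
induction on `n` passes from values in `F` to values in `E →L[ℝ] F`, so that the two spaces share
a universe. -/
theorem contDiffOn_intervalIntegral_nat {E : Type u} [NormedAddCommGroup E]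
    [NormedSpace ℝ E] {K : Set E} (hK : IsCompact K) (hKc : Convex ℝ K)
    (hKu : UniqueDiffOn ℝ K) (n : ℕ) :
    ∀ {F : Type u} [NormedAddCommGroup F] [NormedSpace ℝ F] {f : ℝ × E → F},
      ContDiffOn ℝ n f (Icc 0 1 ×ˢ K) →
        ContDiffOn ℝ n (fun u => ∫ a in (0 : ℝ)..1, f (a, u)) K := by
  induction n with
  | zero =>
    intro F _ _ f hf
    exact contDiffOn_zero.2 (continuousOn_intervalIntegral hK hf.continuousOn)
  | succ n ih =>
    intro F _ _ f hf
    have hu : UniqueDiffOn ℝ (Icc (0 : ℝ) 1 ×ˢ K) := (uniqueDiffOn_Icc zero_lt_one).prod hKu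
    push_cast at hf ⊢
    have hf' : ContDiffOn ℝ n (fun p => (fderivWithin ℝ f (Icc 0 1 ×ˢ K) p).comp
        (ContinuousLinearMap.inr ℝ ℝ E)) (Icc 0 1 ×ˢ K) :=
      ((contDiffOn_succ_iff_fderivWithin hu).1 hf).2.2.clm_comp contDiffOn_const
    have hd : ∀ a ∈ Icc (0 : ℝ) 1, ∀ u ∈ K, HasFDerivWithinAt (fun u => f (a, u))
        ((fderivWithin ℝ f (Icc 0 1 ×ˢ K) (a, u)).comp (ContinuousLinearMap.inr ℝ ℝ E)) K u :=
      fun a ha u hu => ((hf.differentiableOn (by simp) (a, u) ⟨ha, hu⟩).hasFDerivWithinAt).comp u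
        (hasFDerivAt_prodMk_right a u).hasFDerivWithinAt fun v hv => ⟨ha, hv⟩
    have hder := fun u hu => hasFDerivWithinAt_intervalIntegral hK hKc hf.continuousOn
      hf'.continuousOn hd (u := u) hu
    rw [contDiffOn_succ_iff_hasFDerivWithinAt_of_uniqueDiffOn hKu]
    exact ⟨by simp, _, ih hf', hder⟩

end Parametric

/-! ### Smoothness of inverse maps -/

/-- A continuous inverse of a smooth map with invertible differential is smooth. The domain `U` of
the inverse is arbitrary, for instance the image of a half ball. -/
theorem contDiffOn_of_leftInverse {E F : Type*} [NormedAddCommGroup E] [NormedSpace ℝ E]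
    [CompleteSpace E] [NormedAddCommGroup F] [NormedSpace ℝ F] {T : Set E} {U : Set F}
    {φ : E → F} {f : F → E} (hT : UniqueDiffOn ℝ T) (hφ : ContDiffOn ℝ ∞ φ T)
    (hinv : ∀ u ∈ T, (fderivWithin ℝ φ T u).IsInvertible) (hf : ContinuousOn f U)
    (hm : MapsTo f U T) (hl : ∀ v ∈ U, φ (f v) = v) : ContDiffOn ℝ ∞ f U := by
  have hd : ∀ v ∈ U, HasFDerivWithinAt f (fderivWithin ℝ φ T (f v)).inverse U v := by
    intro v hv
    obtain ⟨e, he⟩ := hinv _ (hm hv)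
    have h1 : HasFDerivWithinAt φ (e : E →L[ℝ] F) T (f v) := by
      rw [he]; exact (hφ.differentiableOn (by simp) _ (hm hv)).hasFDerivWithinAt
    rw [← he, ContinuousLinearMap.inverse_equiv]
    refine HasFDerivWithinAt.of_local_left_inverse ?_ h1 hv ?_
    · exact tendsto_nhdsWithin_iff.2 ⟨hf v hv, eventually_mem_nhdsWithin.mono fun w hw => hm hw⟩
    · exact eventually_mem_nhdsWithin.mono fun w hw => hl w hw
  rw [contDiffOn_infty]
  intro n
  -- The formula `Df = (Dφ ∘ f)⁻¹` raises the order of differentiability step by step.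
  induction n with
  | zero => exact contDiffOn_zero.2 hf
  | succ n ih =>
    intro v hv
    push_cast
    rw [contDiffWithinAt_succ_iff_hasFDerivWithinAt (by simp)]
    refine ⟨U, ?_, by simp, _, hd, ?_⟩
    · rw [insert_eq_of_mem hv]; exact self_mem_nhdsWithin
    · obtain ⟨e, he⟩ := hinv _ (hm hv)
      have h1 : ContDiffWithinAt ℝ n (fun w => fderivWithin ℝ φ T (f w)) U v :=
        ((hφ.fderivWithin hT (m := n) (by exact_mod_cast le_top)) _ (hm hv)).comp v (ih v hv) hm
      have h2 : ContDiffAt ℝ n ContinuousLinearMap.inverse (fderivWithin ℝ φ T (f v)) := by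
        rw [← he]; exact contDiffAt_map_inverse e
      exact h2.comp_contDiffWithinAt v h1

end PotentialRay

namespace PotentialRay

/-! ### Trajectories with given initial data -/

variable {d : ℕ} [NeZero d] {M : Type*} [TopologicalSpace M]
  [ChartedSpace (EuclideanHalfSpace d) M]

/-- The point `(x, ξ)` of the tangent bundle, for `ξ` in the model space. -/
def tangentPoint (x : M) (ξ : Coord d) : TangentBundle (𝓡∂ d) M := ⟨x, ξ⟩

theorem lift_eq_tangentPoint_iff {γ : ℝ → M} {J : Set ℝ} {t : ℝ} {x : M} {ξ : Coord d} :
    lift γ J t = tangentPoint x ξ ↔ γ t = x ∧ velocity γ J t = ξ := lift_eq_iff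

variable [IsManifold (𝓡∂ d) ∞ M]

theorem energy_tangentPoint (g : Metric d M) (q : M → ℝ) (x : M) (ξ : Coord d) :
    energy g q (tangentPoint x ξ) = (1 / 2) * innerAt g x ξ ξ + q x := rfl

omit [IsManifold (𝓡∂ d) ∞ M] in
theorem velocity_mono {γ : ℝ → M} {J J' : Set ℝ} {t : ℝ} (hJ' : UniqueDiffWithinAt ℝ J' t)
    (hγ : ContMDiffWithinAt 𝓘(ℝ, ℝ) (𝓡∂ d) ∞ γ J t) (h : J' ⊆ J) :
    (velocity γ J' t : Coord d) = velocity γ J t := by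
  have := velocity_comp (r := id) (r' := 1) hJ' (hγ.mdifferentiableWithinAt (by simp))
    (hasDerivWithinAt_id t J') h
  simpa using this

theorem FlowsTo.nonneg {g : Metric d M} {q : M → ℝ} {p : TangentBundle (𝓡∂ d) M} {t : ℝ} {y : M}
    (h : FlowsTo g q p t y) : 0 ≤ t := by
  rcases h with ⟨rfl, -⟩ | ⟨h, -⟩
  · exact le_rfl
  · exact h.le

/-- A solution on `[0, t]` passes through its points at all intermediate times. -/
theorem IsHGeodesicOn.flowsTo {g : Metric d M} {q : M → ℝ} {p : TangentBundle (𝓡∂ d) M} {t : ℝ}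
    {γ : ℝ → M} (ht : 0 < t) (hγ : IsHGeodesicOn g q γ (Icc 0 t)) (hp : lift γ (Icc 0 t) 0 = p)
    {u : ℝ} (hu : u ∈ Icc 0 t) : FlowsTo g q p u (γ u) := by
  rcases hu.1.eq_or_lt with h | h
  · subst h
    left
    refine ⟨rfl, ?_⟩
    rw [← hp]; rfl
  · right
    have hsub : Icc 0 u ⊆ Icc 0 t := Icc_subset_Icc_right hu.2
    refine ⟨h, γ, hγ.mono (uniqueDiffOn_Icc ht) (uniqueDiffOn_Icc h) hsub, ?_, rfl⟩
    rw [← hp]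
    have := velocity_mono (γ := γ) (uniqueDiffOn_Icc h 0 (left_mem_Icc.2 h.le))
      (hγ.1 0 (left_mem_Icc.2 ht.le)) hsub
    exact congrArg (tangentPoint (γ 0)) this

theorem FlowsTo.of_le {g : Metric d M} {q : M → ℝ} {p : TangentBundle (𝓡∂ d) M} {t u : ℝ} {y : M}
    (h : FlowsTo g q p t y) (hu : u ∈ Icc 0 t) : ∃ y', FlowsTo g q p u y' := by
  rcases h with ⟨rfl, -⟩ | ⟨ht, γ, hγ, hp, -⟩
  · exact ⟨p.1, Or.inl ⟨le_antisymm hu.2 hu.1, rfl⟩⟩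
  · exact ⟨γ u, hγ.flowsTo ht hp hu⟩

theorem flowPoint_eq {g : Metric d M} {q : M → ℝ} {p : TangentBundle (𝓡∂ d) M} {t : ℝ} {y : M}
    (huniq : ∀ t y y', FlowsTo g q p t y → FlowsTo g q p t y' → y = y')
    (h : FlowsTo g q p t y) : flowPoint g q p t = y := by
  unfold flowPoint
  rw [dif_pos ⟨y, h⟩]
  exact huniq t _ _ (Exists.choose_spec (⟨y, h⟩ : ∃ y, FlowsTo g q p t y)) h

/-- Maupertuis' principle on a compact interval, with the change of parameter
`s(t) = ∫₀ᵗ κ(γ(u)) du`. -/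
theorem IsHGeodesicOn.exists_param {g₁ g₂ : Metric d M} {κ q₁ q₂ : M → ℝ} {E₁ E₂ : ℝ}
    (hκ : ContMDiff (𝓡∂ d) 𝓘(ℝ, ℝ) ∞ κ) (hpos : ∀ x, 0 < κ x)
    (hg : ∀ x v w, innerAt g₂ x v w = κ x * innerAt g₁ x v w)
    (hq₁ : ContMDiff (𝓡∂ d) 𝓘(ℝ, ℝ) ∞ q₁) (hq₂ : ContMDiff (𝓡∂ d) 𝓘(ℝ, ℝ) ∞ q₂)
    (hE : ∀ x, E₁ - q₁ x = κ x * (E₂ - q₂ x)) {γ : ℝ → M} {T : ℝ} (hT : 0 < T)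
    (hγ : IsHGeodesicOn g₁ q₁ γ (Icc 0 T)) (hen : energy g₁ q₁ (lift γ (Icc 0 T) 0) = E₁) :
    ∃ (S : ℝ) (r : ℝ → ℝ), S = ∫ u in (0 : ℝ)..T, κ (γ u) ∧ 0 < S ∧ StrictMonoOn r (Icc 0 S) ∧
      BijOn r (Icc 0 S) (Icc 0 T) ∧ ContDiffOn ℝ ∞ r (Icc 0 S) ∧
      (∀ t ∈ Icc 0 T, r (∫ u in (0 : ℝ)..t, κ (γ u)) = t) ∧
      (∀ s ∈ Icc 0 S, HasDerivWithinAt r (κ (γ (r s)))⁻¹ (Icc 0 S) s) ∧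
      IsHGeodesicOn g₂ q₂ (γ ∘ r) (Icc 0 S) ∧
      ∀ s ∈ Icc 0 S, (velocity (γ ∘ r) (Icc 0 S) s : Coord d) =
        (κ (γ (r s)))⁻¹ • velocity γ (Icc 0 T) (r s) := by
  have hh : ContDiffOn ℝ ∞ (fun u => κ (γ u)) (Icc 0 T) := by
    rw [← contMDiffOn_iff_contDiffOn]; exact hκ.comp_contMDiffOn hγ.1
  obtain ⟨r, hs1, hr1, hs2, hr2, hr3, hr4, hs3, hr5⟩ :=
    exists_inverse_of_integral hT hh fun t _ => hpos _
  have hS : 0 < ∫ u in (0 : ℝ)..T, κ (γ u) := by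
    have := hs1 (left_mem_Icc.2 hT.le) (right_mem_Icc.2 hT.le) hT
    simpa using this
  refine ⟨_, r, rfl, hS, hr1, hr2, hr3, hr4, hr5, ?_, fun s hs => ?_⟩
  · exact hγ.maupertuis hκ hpos hg hq₂ hE (uniqueDiffOn_Icc hT) (uniqueDiffOn_Icc hS)
      (fun t ht => (energy_lift_eq hq₁ hT hγ ht).trans hen) hr3 hr2.mapsTo hr5
  · exact velocity_comp (uniqueDiffOn_Icc hS s hs)
      ((hγ.1 _ (hr2.mapsTo hs)).mdifferentiableWithinAt (by simp)) (hr5 s hs) hr2.mapsTo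

theorem integral_eq_sub_of_hasDerivWithinAt_Icc {r h : ℝ → ℝ} {S : ℝ} (hS : 0 ≤ S)
    (hr : ∀ s ∈ Icc 0 S, HasDerivWithinAt r (h s) (Icc 0 S) s) (hh : ContinuousOn h (Icc 0 S)) :
    ∫ s in (0 : ℝ)..S, h s = r S - r 0 := by
  refine intervalIntegral.integral_eq_sub_of_hasDerivAt_of_le hS
    (fun s hs => (hr s hs).continuousWithinAt) (fun s hs => ?_) ?_
  · exact (hr s (Ioo_subset_Icc_self hs)).hasDerivAt (Icc_mem_nhds hs.1 hs.2)
  · exact (hh.intervalIntegrable_of_Icc hS)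

/-- Maupertuis' principle for the flows, with the change of parameter in both directions. -/
theorem FlowsTo.maupertuis {g₁ g₂ : Metric d M} {κ q₁ q₂ : M → ℝ} {E₁ E₂ : ℝ}
    (hκ : ContMDiff (𝓡∂ d) 𝓘(ℝ, ℝ) ∞ κ) (hpos : ∀ x, 0 < κ x)
    (hg : ∀ x v w, innerAt g₂ x v w = κ x * innerAt g₁ x v w)
    (hq₁ : ContMDiff (𝓡∂ d) 𝓘(ℝ, ℝ) ∞ q₁) (hq₂ : ContMDiff (𝓡∂ d) 𝓘(ℝ, ℝ) ∞ q₂)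
    (hE : ∀ x, E₁ - q₁ x = κ x * (E₂ - q₂ x)) {x : M} {ξ : Coord d}
    (hen : energy g₁ q₁ (tangentPoint x ξ) = E₁) {t : ℝ} (ht : 0 < t) {y : M}
    (h : FlowsTo g₁ q₁ (tangentPoint x ξ) t y) :
    ∃ γ σ : ℝ → M, ∃ s : ℝ, 0 < s ∧ IsHGeodesicOn g₁ q₁ γ (Icc 0 t) ∧
      lift γ (Icc 0 t) 0 = tangentPoint x ξ ∧ γ t = y ∧
      IsHGeodesicOn g₂ q₂ σ (Icc 0 s) ∧
      lift σ (Icc 0 s) 0 = tangentPoint x ((κ x)⁻¹ • ξ) ∧ σ s = y ∧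
      s = ∫ u in (0 : ℝ)..t, κ (γ u) ∧ t = ∫ u in (0 : ℝ)..s, (κ (σ u))⁻¹ := by
  rcases h with ⟨rfl, -⟩ | ⟨-, γ, hγ, hp, hy⟩
  · exact absurd ht (lt_irrefl _)
  obtain ⟨S, r, hS, hS0, hr1, hr2, hr3, hr4, hr5, hσ, hv⟩ :=
    hγ.exists_param hκ hpos hg hq₁ hq₂ hE ht (by rw [hp]; exact hen)
  have hr0 : r 0 = 0 := by simpa using hr4 0 (left_mem_Icc.2 ht.le)
  have hrS : r S = t := by rw [hS]; exact hr4 t (right_mem_Icc.2 ht.le)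
  obtain ⟨hx, hξ⟩ := lift_eq_tangentPoint_iff.1 hp
  refine ⟨γ, γ ∘ r, S, hS0, hγ, hp, hy, hσ, ?_, by simp [hrS, hy], hS, ?_⟩
  · refine lift_eq_tangentPoint_iff.2 ⟨by simp [hr0, hx], ?_⟩
    rw [hv 0 (left_mem_Icc.2 hS0.le), hr0, hx, hξ]
  · have hc : ContinuousOn (fun s => (κ (γ (r s)))⁻¹) (Icc 0 S) :=
      (hκ.continuous.comp_continuousOn hσ.1.continuousOn).inv₀ fun s _ => (hpos _).ne'
    have := integral_eq_sub_of_hasDerivWithinAt_Icc hS0.le hr5 hc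
    simp only [Function.comp]
    rw [this, hrS, hr0, sub_zero]

/-! ### Simple systems -/

/-- The conformal factor `2 (H₀ - q)`. -/
def jacobiFactor (q : M → ℝ) (H₀ : ℝ) (x : M) : ℝ := 2 * (H₀ - q x)

section Simple
variable {g : Metric d M} {q : M → ℝ} {H₀ : ℝ}

omit [IsManifold (𝓡∂ d) ∞ M] in
theorem contMDiff_jacobiFactor (hq : ContMDiff (𝓡∂ d) 𝓘(ℝ, ℝ) ∞ q) :
    ContMDiff (𝓡∂ d) 𝓘(ℝ, ℝ) ∞ (jacobiFactor q H₀) :=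
  contMDiff_const.mul (contMDiff_const.sub hq)

theorem energy_eq_iff {x : M} {ξ : Coord d} :
    energy g q (tangentPoint x ξ) = H₀ ↔ innerAt g x ξ ξ = jacobiFactor q H₀ x := by
  rw [energy_tangentPoint, jacobiFactor]
  constructor <;> intro h <;> linarith

theorem hExp_iff {x : M} {v : Coord d} {y : M} :
    HExp g q H₀ x v y ↔ ∃ (t : ℝ) (ξ : Coord d), 0 ≤ t ∧
      innerAt g x ξ ξ = jacobiFactor q H₀ x ∧ v = t • ξ ∧ FlowsTo g q (tangentPoint x ξ) t y := by
  constructor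
  · rintro ⟨t, ξ, h1, h2, h3, h4⟩
    exact ⟨t, ξ, h1, energy_eq_iff.1 h2, h3, h4⟩
  · rintro ⟨t, ξ, h1, h2, h3, h4⟩
    exact ⟨t, ξ, h1, energy_eq_iff.2 h2, h3, h4⟩

/-- If the energy is critical at `x`, then `exp_x^H` is defined at `0` only, and `M` would be
a point. -/
theorem jacobiFactor_pos (hs : ∀ x : M, IsDiffeoOnto x (HExp g q H₀ x)) (x : M) :
    0 < jacobiFactor q H₀ x := by
  obtain ⟨F, G, -, -, hF, hG⟩ := hs x
  have hR : ∀ y, HExp g q H₀ x (G y) y := fun y => (hG _ y).2 rfl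
  obtain ⟨t, ξ, -, hξ, -⟩ := hExp_iff.1 (hR x)
  refine lt_of_le_of_ne (hξ ▸ innerAt_self_nonneg g x ξ) fun h0 => ?_
  have hsub : ∀ y, y = F 0 := by
    intro y
    obtain ⟨t, ξ, -, hξ, hv, -⟩ := hExp_iff.1 (hR y)
    have : ξ = 0 := by
      by_contra hne
      have := innerAt_pos g x hne
      rw [hξ, ← h0] at this
      exact lt_irrefl _ this
    rw [this, smul_zero] at hv
    rw [← hF _ _ (hR y), hv]
  have hu := uniqueDiffOn_extChartAt_target (I := 𝓡∂ d) x _ (mem_extChartAt_target x)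
  have hacc := hu.accPt
  rw [accPt_iff_frequently] at hacc
  obtain ⟨y, hy1, hy2⟩ := hacc.exists
  apply hy1
  rw [← (extChartAt (𝓡∂ d) x).right_inv hy2]
  congr 1
  rw [hsub ((extChartAt (𝓡∂ d) x).symm y)]
  exact (hsub x).symm

theorem flowsTo_unique (hs : ∀ x : M, IsDiffeoOnto x (HExp g q H₀ x)) {x : M} {ξ : Coord d}
    (hξ : innerAt g x ξ ξ = jacobiFactor q H₀ x) {t : ℝ} {y y' : M}
    (h : FlowsTo g q (tangentPoint x ξ) t y) (h' : FlowsTo g q (tangentPoint x ξ) t y') :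
    y = y' := by
  obtain ⟨F, G, -, -, hF, hG⟩ := hs x
  rw [← hF _ y (hExp_iff.2 ⟨t, ξ, h.nonneg, hξ, rfl, h⟩),
    ← hF _ y' (hExp_iff.2 ⟨t, ξ, h.nonneg, hξ, rfl, h'⟩)]

theorem flowPoint_eq_of_flowsTo (hs : ∀ x : M, IsDiffeoOnto x (HExp g q H₀ x)) {x : M}
    {ξ : Coord d} (hξ : innerAt g x ξ ξ = jacobiFactor q H₀ x) {t : ℝ} {y : M}
    (h : FlowsTo g q (tangentPoint x ξ) t y) : flowPoint g q (tangentPoint x ξ) t = y :=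
  flowPoint_eq (fun _ _ _ => flowsTo_unique hs hξ) h

theorem flowPoint_eq_of_isHGeodesicOn (hs : ∀ x : M, IsDiffeoOnto x (HExp g q H₀ x)) {x : M}
    {ξ : Coord d} (hξ : innerAt g x ξ ξ = jacobiFactor q H₀ x) {t : ℝ} {γ : ℝ → M} (ht : 0 < t)
    (hγ : IsHGeodesicOn g q γ (Icc 0 t)) (hp : lift γ (Icc 0 t) 0 = tangentPoint x ξ) :
    EqOn (flowPoint g q (tangentPoint x ξ)) γ (Icc 0 t) := fun _ hu =>
  flowPoint_eq_of_flowsTo hs hξ (hγ.flowsTo ht hp hu)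

/-- The time and the vector of energy `H₀` in the definition of `exp_x^H(t ξ)` are determined by
`t ξ`, apart from the vector at time `0`. -/
theorem flowsTo_of_hExp {x : M} {ξ : Coord d} (hpos : 0 < jacobiFactor q H₀ x)
    (hξ : innerAt g x ξ ξ = jacobiFactor q H₀ x) {t : ℝ} (ht : 0 ≤ t) {y : M}
    (h : HExp g q H₀ x (t • ξ) y) : FlowsTo g q (tangentPoint x ξ) t y := by
  obtain ⟨t', ξ', ht', hξ', hv, hf⟩ := hExp_iff.1 h
  have h1 : t ^ 2 * jacobiFactor q H₀ x = t' ^ 2 * jacobiFactor q H₀ x := by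
    have := congrArg (fun v => innerAt g x v v) hv
    simp only [map_smul, smul_apply, smul_eq_mul, hξ, hξ'] at this
    linarith
  have h2 : t = t' := by
    have := mul_right_cancel₀ hpos.ne' h1
    exact (pow_left_inj₀ ht ht' two_ne_zero).1 this
  subst h2
  rcases ht.eq_or_lt with h0 | h0
  · subst h0
    rcases hf with ⟨-, hy⟩ | ⟨h, -⟩
    · exact Or.inl ⟨rfl, hy⟩
    · exact absurd h (lt_irrefl _)
  · rw [smul_right_injective _ h0.ne' hv]; exact hf

variable [CompactSpace M]

/-- The flow is defined exactly up to the exit time: the set of its times is the trace of the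
compact domain of `exp_x^H` on a ray. -/
theorem setOf_flowsTo_eq_Icc (hs : ∀ x : M, IsDiffeoOnto x (HExp g q H₀ x)) {x : M} {ξ : Coord d}
    (hξ : innerAt g x ξ ξ = jacobiFactor q H₀ x) :
    {t | ∃ y, FlowsTo g q (tangentPoint x ξ) t y} = Icc 0 (exitTime g q (tangentPoint x ξ)) := by
  set τs := {t | ∃ y, FlowsTo g q (tangentPoint x ξ) t y} with hτs
  have hpos := jacobiFactor_pos hs x
  obtain ⟨F, G, -, hGs, hF, hG⟩ := hs x
  have hcomp : IsCompact (range G) := isCompact_range hGs.continuous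
  have heq : τs = Ici 0 ∩ (fun t : ℝ => t • ξ) ⁻¹' range G := by
    ext t
    constructor
    · rintro ⟨y, h⟩
      exact ⟨h.nonneg, y, (hG _ _).1 (hExp_iff.2 ⟨t, ξ, h.nonneg, hξ, rfl, h⟩)⟩
    · rintro ⟨ht, y, hy⟩
      exact ⟨y, flowsTo_of_hExp hpos hξ ht ((hG _ _).2 hy)⟩
  have hclosed : IsClosed τs := by
    rw [heq]
    exact isClosed_Ici.inter (hcomp.isClosed.preimage (by fun_prop))
  have hne : ξ ≠ 0 := by
    rintro rfl
    simp at hξ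
    exact hpos.ne hξ
  have hbdd : BddAbove τs := by
    obtain ⟨C, hC⟩ := hcomp.isBounded.exists_norm_le
    refine ⟨C / ‖ξ‖, fun t ht => ?_⟩
    rw [heq] at ht
    have := hC _ ht.2
    rw [norm_smul, Real.norm_of_nonneg ht.1] at this
    rwa [le_div_iff₀ (norm_pos_iff.2 hne)]
  have h0 : (0 : ℝ) ∈ τs := ⟨x, Or.inl ⟨rfl, rfl⟩⟩
  have hmem : exitTime g q (tangentPoint x ξ) ∈ τs := hclosed.csSup_mem ⟨0, h0⟩ hbdd
  ext t
  constructor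
  · intro ht
    exact ⟨ht.choose_spec.nonneg, le_csSup hbdd ht⟩
  · intro ht
    obtain ⟨y, hy⟩ := hmem
    exact hy.of_le ht

end Simple

end PotentialRay

namespace PotentialRay

/-! ### Correspondence of the potential flow and the geodesic flow -/

variable {d : ℕ} [NeZero d] {M : Type*} [TopologicalSpace M]
  [ChartedSpace (EuclideanHalfSpace d) M] [IsManifold (𝓡∂ d) ∞ M]

section Correspondence
variable {g g' : Metric d M} {q : M → ℝ} {H₀ : ℝ}

/-- The parameter of the reparametrized curve, `s(t) = ∫₀ᵗ 2 (H₀ - q(γ(u))) du`, as a function of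
the initial data of `γ`. -/
noncomputable def jacobiTime (g : Metric d M) (q : M → ℝ) (H₀ : ℝ) (p : TangentBundle (𝓡∂ d) M)
    (t : ℝ) : ℝ :=
  ∫ u in (0 : ℝ)..t, jacobiFactor q H₀ (flowPoint g q p u)

theorem jacobiTime_eq (hs : ∀ x : M, IsDiffeoOnto x (HExp g q H₀ x)) {x : M}
    {ξ : Coord d} (hξ : innerAt g x ξ ξ = jacobiFactor q H₀ x) {t : ℝ} {γ : ℝ → M} (ht : 0 < t)
    (hγ : IsHGeodesicOn g q γ (Icc 0 t)) (hp : lift γ (Icc 0 t) 0 = tangentPoint x ξ) :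
    jacobiTime g q H₀ (tangentPoint x ξ) t = ∫ u in (0 : ℝ)..t, jacobiFactor q H₀ (γ u) := by
  refine intervalIntegral.integral_congr fun u hu => ?_
  rw [uIcc_of_le ht.le] at hu
  exact congrArg _ (flowPoint_eq_of_isHGeodesicOn hs hξ ht hγ hp hu)

/-- The vector `ξ / (2 (H₀ - q(x)))` is a unit vector of `2 (H₀ - q) g`. -/
theorem energy_jacobi {x : M} {ξ : Coord d}
    (hg : ∀ x v w, innerAt g' x v w = jacobiFactor q H₀ x * innerAt g x v w)
    (hpos : 0 < jacobiFactor q H₀ x) (hξ : innerAt g x ξ ξ = jacobiFactor q H₀ x) :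
    innerAt g' x ((jacobiFactor q H₀ x)⁻¹ • ξ) ((jacobiFactor q H₀ x)⁻¹ • ξ) = 1 := by
  simp only [map_smul, smul_apply, smul_eq_mul, hg, hξ]
  field_simp

/-- The geodesic flow of the metric `2 (H₀ - q) g` is a reparametrization of the potential flow. -/
theorem flowsTo_jacobi_iff (hq : ContMDiff (𝓡∂ d) 𝓘(ℝ, ℝ) ∞ q)
    (hg : ∀ x v w, innerAt g' x v w = jacobiFactor q H₀ x * innerAt g x v w)
    (hs : ∀ x : M, IsDiffeoOnto x (HExp g q H₀ x)) {x : M}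
    {ξ : Coord d} (hξ : innerAt g x ξ ξ = jacobiFactor q H₀ x) {s : ℝ} {y : M} :
    FlowsTo g' (fun _ => 0) (tangentPoint x ((jacobiFactor q H₀ x)⁻¹ • ξ)) s y ↔
      ∃ t, FlowsTo g q (tangentPoint x ξ) t y ∧ s = jacobiTime g q H₀ (tangentPoint x ξ) t := by
  have hpos := jacobiFactor_pos hs
  have hρ : ContMDiff (𝓡∂ d) 𝓘(ℝ, ℝ) ∞ (jacobiFactor q H₀) := contMDiff_jacobiFactor hq
  constructor
  · intro h
    rcases h.nonneg.eq_or_lt with h0 | h0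
    · subst h0
      rcases h with ⟨-, hy⟩ | ⟨h, -⟩
      · exact ⟨0, Or.inl ⟨rfl, hy⟩, by simp [jacobiTime]⟩
      · exact absurd h (lt_irrefl _)
    · have hρ' : ContMDiff (𝓡∂ d) 𝓘(ℝ, ℝ) ∞ fun x => (jacobiFactor q H₀ x)⁻¹ :=
        hρ.inv₀ fun x => (hpos x).ne'
      obtain ⟨σ, γ, t, ht0, -, -, -, hγ, hp, hy, -, hst⟩ := h.maupertuis (g₂ := g) (q₂ := q)
        (κ := fun x => (jacobiFactor q H₀ x)⁻¹) (E₁ := 1 / 2) (E₂ := H₀)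
        hρ' (fun x => inv_pos.2 (hpos x))
        (fun x v w => by rw [hg, inv_mul_cancel_left₀ (hpos x).ne']) contMDiff_const hq
        (fun x => by
          have := (hpos x).ne'
          have h2 : H₀ - q x = jacobiFactor q H₀ x / 2 := by rw [jacobiFactor]; ring
          rw [h2]; field_simp; ring)
        (by rw [energy_tangentPoint, energy_jacobi hg (hpos x) hξ]; ring) h0
      rw [inv_inv, smul_inv_smul₀ (hpos x).ne'] at hp
      refine ⟨t, Or.inr ⟨ht0, γ, hγ, hp, hy⟩, ?_⟩
      rw [hst, jacobiTime_eq hs hξ ht0 hγ hp]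
      simp only [inv_inv]
  · rintro ⟨t, h, rfl⟩
    rcases h.nonneg.eq_or_lt with h0 | h0
    · subst h0
      rcases h with ⟨-, hy⟩ | ⟨h, -⟩
      · exact Or.inl ⟨by simp [jacobiTime], hy⟩
      · exact absurd h (lt_irrefl _)
    · obtain ⟨γ, σ, s, hs0, hγ, hp, -, hσ, hp', hy, hst, -⟩ := h.maupertuis (g₂ := g')
        (q₂ := fun _ => 0) (E₁ := H₀) (E₂ := 1 / 2) hρ hpos hg hq contMDiff_const
        (fun x => by rw [jacobiFactor]; ring) (energy_eq_iff.2 hξ) h0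
      rw [jacobiTime_eq hs hξ h0 hγ hp, ← hst]
      exact Or.inr ⟨hs0, σ, hσ, hp', hy⟩

/-- Properties of the change of parameter along a trajectory. -/
theorem jacobiTime_props (hq : ContMDiff (𝓡∂ d) 𝓘(ℝ, ℝ) ∞ q)
    (hs : ∀ x : M, IsDiffeoOnto x (HExp g q H₀ x)) {x : M}
    {ξ : Coord d} (hξ : innerAt g x ξ ξ = jacobiFactor q H₀ x) {t : ℝ} {y : M} (ht : 0 ≤ t)
    (h : FlowsTo g q (tangentPoint x ξ) t y) :
    StrictMonoOn (jacobiTime g q H₀ (tangentPoint x ξ)) (Icc 0 t) ∧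
    BijOn (jacobiTime g q H₀ (tangentPoint x ξ)) (Icc 0 t)
      (Icc 0 (jacobiTime g q H₀ (tangentPoint x ξ) t)) ∧
    ∀ u ∈ Icc 0 t, HasDerivWithinAt (jacobiTime g q H₀ (tangentPoint x ξ))
      (jacobiFactor q H₀ (flowPoint g q (tangentPoint x ξ) u)) (Icc 0 t) u := by
  rcases h with ⟨rfl, -⟩ | ⟨h0, γ, hγ, hp, -⟩
  · have h0 : jacobiTime g q H₀ (tangentPoint x ξ) 0 = 0 := by simp [jacobiTime]
    simp only [h0, Icc_self]
    refine ⟨subsingleton_singleton.strictMonoOn _, ?_, ?_⟩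
    · simp [h0]
    · rintro u rfl
      exact hasDerivWithinAt_iff_hasFDerivWithinAt.2 HasFDerivWithinAt.singleton
  · have heq := flowPoint_eq_of_isHGeodesicOn hs hξ h0 hγ hp
    have hh : ContDiffOn ℝ ∞
        (fun u => jacobiFactor q H₀ (flowPoint g q (tangentPoint x ξ) u)) (Icc 0 t) := by
      rw [← contMDiffOn_iff_contDiffOn]
      exact ((contMDiff_jacobiFactor hq).comp_contMDiffOn hγ.1).congr
        fun u hu => congrArg _ (heq hu)
    obtain ⟨r, h1, -, h2, -, -, -, h3, -⟩ :=
      exists_inverse_of_integral h0 hh fun u _ => jacobiFactor_pos hs _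
    exact ⟨h1, h2, h3⟩

section Compact
variable [CompactSpace M]

theorem exists_flowsTo_exitTime (hs : ∀ x : M, IsDiffeoOnto x (HExp g q H₀ x)) {x : M}
    {ξ : Coord d} (hξ : innerAt g x ξ ξ = jacobiFactor q H₀ x) :
    0 ≤ exitTime g q (tangentPoint x ξ) ∧
      ∃ y, FlowsTo g q (tangentPoint x ξ) (exitTime g q (tangentPoint x ξ)) y := by
  have h := setOf_flowsTo_eq_Icc hs hξ
  have h0 : (0 : ℝ) ∈ {t | ∃ y, FlowsTo g q (tangentPoint x ξ) t y} := ⟨x, Or.inl ⟨rfl, rfl⟩⟩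
  rw [h] at h0
  refine ⟨h0.2, ?_⟩
  have : exitTime g q (tangentPoint x ξ) ∈ {t | ∃ y, FlowsTo g q (tangentPoint x ξ) t y} := by
    rw [h]; exact right_mem_Icc.2 h0.2
  exact this

theorem exitTime_jacobi (hq : ContMDiff (𝓡∂ d) 𝓘(ℝ, ℝ) ∞ q)
    (hg : ∀ x v w, innerAt g' x v w = jacobiFactor q H₀ x * innerAt g x v w)
    (hs : ∀ x : M, IsDiffeoOnto x (HExp g q H₀ x)) {x : M}
    {ξ : Coord d} (hξ : innerAt g x ξ ξ = jacobiFactor q H₀ x) :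
    exitTime g' (fun _ => 0) (tangentPoint x ((jacobiFactor q H₀ x)⁻¹ • ξ)) =
      jacobiTime g q H₀ (tangentPoint x ξ) (exitTime g q (tangentPoint x ξ)) := by
  obtain ⟨h0, y, hy⟩ := exists_flowsTo_exitTime hs hξ
  refine IsGreatest.csSup_eq ⟨⟨y, (flowsTo_jacobi_iff hq hg hs hξ).2 ⟨_, hy, rfl⟩⟩, ?_⟩
  rintro s ⟨y', hy'⟩
  obtain ⟨t, ht, rfl⟩ := (flowsTo_jacobi_iff hq hg hs hξ).1 hy'
  have htm : t ∈ {t | ∃ y, FlowsTo g q (tangentPoint x ξ) t y} := ⟨y', ht⟩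
  rw [setOf_flowsTo_eq_Icc hs hξ] at htm
  exact (jacobiTime_props hq hs hξ h0 hy).1.monotoneOn htm (right_mem_Icc.2 h0) htm.2

theorem flowsTo_jacobi_unique (hq : ContMDiff (𝓡∂ d) 𝓘(ℝ, ℝ) ∞ q)
    (hg : ∀ x v w, innerAt g' x v w = jacobiFactor q H₀ x * innerAt g x v w)
    (hs : ∀ x : M, IsDiffeoOnto x (HExp g q H₀ x)) {x : M}
    {ξ : Coord d} (hξ : innerAt g x ξ ξ = jacobiFactor q H₀ x) {s : ℝ} {z z' : M}
    (hz : FlowsTo g' (fun _ => 0) (tangentPoint x ((jacobiFactor q H₀ x)⁻¹ • ξ)) s z)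
    (hz' : FlowsTo g' (fun _ => 0) (tangentPoint x ((jacobiFactor q H₀ x)⁻¹ • ξ)) s z') :
    z = z' := by
  obtain ⟨h0, y₁, hy₁⟩ := exists_flowsTo_exitTime hs hξ
  have hset := setOf_flowsTo_eq_Icc hs hξ
  obtain ⟨u, hu, rfl⟩ := (flowsTo_jacobi_iff hq hg hs hξ).1 hz
  obtain ⟨u', hu', he⟩ := (flowsTo_jacobi_iff hq hg hs hξ).1 hz'
  have hum : u ∈ {t | ∃ y, FlowsTo g q (tangentPoint x ξ) t y} := ⟨z, hu⟩
  have hum' : u' ∈ {t | ∃ y, FlowsTo g q (tangentPoint x ξ) t y} := ⟨z', hu'⟩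
  rw [hset] at hum hum'
  have := (jacobiTime_props hq hs hξ h0 hy₁).1.injOn hum hum' he
  subst this
  exact flowsTo_unique hs hξ hu hu'

theorem flowPoint_jacobi (hq : ContMDiff (𝓡∂ d) 𝓘(ℝ, ℝ) ∞ q)
    (hg : ∀ x v w, innerAt g' x v w = jacobiFactor q H₀ x * innerAt g x v w)
    (hs : ∀ x : M, IsDiffeoOnto x (HExp g q H₀ x)) {x : M}
    {ξ : Coord d} (hξ : innerAt g x ξ ξ = jacobiFactor q H₀ x) {t : ℝ}
    (ht : t ∈ Icc 0 (exitTime g q (tangentPoint x ξ))) :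
    flowPoint g' (fun _ => 0) (tangentPoint x ((jacobiFactor q H₀ x)⁻¹ • ξ))
      (jacobiTime g q H₀ (tangentPoint x ξ) t) = flowPoint g q (tangentPoint x ξ) t := by
  have hset := setOf_flowsTo_eq_Icc hs hξ
  obtain ⟨y, hy⟩ : t ∈ {t | ∃ y, FlowsTo g q (tangentPoint x ξ) t y} := by rw [hset]; exact ht
  rw [flowPoint_eq_of_flowsTo hs hξ hy]
  exact flowPoint_eq (fun s z z' hz hz' => flowsTo_jacobi_unique hq hg hs hξ hz hz')
    ((flowsTo_jacobi_iff hq hg hs hξ).2 ⟨t, hy, rfl⟩)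

theorem integral_jacobi (hq : ContMDiff (𝓡∂ d) 𝓘(ℝ, ℝ) ∞ q)
    (hg : ∀ x v w, innerAt g' x v w = jacobiFactor q H₀ x * innerAt g x v w)
    (hs : ∀ x : M, IsDiffeoOnto x (HExp g q H₀ x)) {x : M}
    {ξ : Coord d} (hξ : innerAt g x ξ ξ = jacobiFactor q H₀ x) (f : M → ℝ)
    (hf : IntervalIntegrable (fun t => f (flowPoint g q (tangentPoint x ξ) t)) volume 0
      (exitTime g q (tangentPoint x ξ))) :
    IntervalIntegrable (fun s => f (flowPoint g' (fun _ => 0)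
        (tangentPoint x ((jacobiFactor q H₀ x)⁻¹ • ξ)) s) / jacobiFactor q H₀ (flowPoint g'
          (fun _ => 0) (tangentPoint x ((jacobiFactor q H₀ x)⁻¹ • ξ)) s)) volume 0
      (exitTime g' (fun _ => 0) (tangentPoint x ((jacobiFactor q H₀ x)⁻¹ • ξ))) ∧
    flowTransform g q f (tangentPoint x ξ) = xrayTransform g' (fun x => f x / jacobiFactor q H₀ x)
      (tangentPoint x ((jacobiFactor q H₀ x)⁻¹ • ξ)) := by
  obtain ⟨h0, y₁, hy₁⟩ := exists_flowsTo_exitTime hs hξ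
  obtain ⟨hmono, hbij, hder⟩ := jacobiTime_props hq hs hξ h0 hy₁
  have hflow := fun t ht => flowPoint_jacobi hq hg hs hξ (t := t) ht
  unfold xrayTransform flowTransform
  rw [exitTime_jacobi hq hg hs hξ]
  set τ := exitTime g q (tangentPoint x ξ) with hτ
  set s := jacobiTime g q H₀ (tangentPoint x ξ) with hsdef
  have hS0 : 0 ≤ s τ := (hbij.mapsTo (right_mem_Icc.2 h0)).1
  set φ : ℝ → ℝ := fun σ => f (flowPoint g' (fun _ => 0)
        (tangentPoint x ((jacobiFactor q H₀ x)⁻¹ • ξ)) σ) / jacobiFactor q H₀ (flowPoint g'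
          (fun _ => 0) (tangentPoint x ((jacobiFactor q H₀ x)⁻¹ • ξ)) σ) with hφ
  have hpt : EqOn (fun t => |jacobiFactor q H₀ (flowPoint g q (tangentPoint x ξ) t)| • φ (s t))
      (fun t => f (flowPoint g q (tangentPoint x ξ) t)) (Icc 0 τ) := by
    intro t ht
    have hp := jacobiFactor_pos hs (flowPoint g q (tangentPoint x ξ) t)
    simp only [hφ, hflow t ht, abs_of_pos hp, smul_eq_mul]
    field_simp
  rw [intervalIntegrable_iff_integrableOn_Icc_of_le h0] at hf
  rw [intervalIntegrable_iff_integrableOn_Icc_of_le hS0, intervalIntegral.integral_of_le h0,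
    intervalIntegral.integral_of_le hS0, ← integral_Icc_eq_integral_Ioc,
    ← integral_Icc_eq_integral_Ioc, ← hbij.image_eq]
  constructor
  · rw [integrableOn_image_iff_integrableOn_abs_deriv_smul measurableSet_Icc hder hbij.injOn]
    exact hf.congr_fun hpt.symm measurableSet_Icc
  · rw [integral_image_eq_integral_abs_deriv_smul measurableSet_Icc hder hbij.injOn]
    exact setIntegral_congr_fun measurableSet_Icc hpt.symm

end Compact

end Correspondence

end PotentialRay

namespace PotentialRay
variable {d : ℕ} [NeZero d] {M : Type*} [TopologicalSpace M]
  [ChartedSpace (EuclideanHalfSpace d) M]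

/-! ### The Riemannian exponential map and the geodesic flow -/

/-- The differential of a map to a vector space, on the model space. -/
noncomputable def diffAt {V : Type*} [NormedAddCommGroup V] [NormedSpace ℝ V] (f : M → V) (y : M) :
    Coord d →L[ℝ] V :=
  mfderiv (𝓡∂ d) 𝓘(ℝ, V) f y

theorem hasMFDerivAt_diffAt {V : Type*} [NormedAddCommGroup V] [NormedSpace ℝ V] {f : M → V}
    (hf : ContMDiff (𝓡∂ d) 𝓘(ℝ, V) ∞ f) (y : M) :
    HasMFDerivAt (𝓡∂ d) 𝓘(ℝ, V) f y (diffAt (V := V) f y) :=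
  (hf.mdifferentiable (by simp) y).hasMFDerivAt

theorem diffAt_smul {V : Type*} [NormedAddCommGroup V] [NormedSpace ℝ V] {c : M → ℝ} {f : M → V}
    (hc : ContMDiff (𝓡∂ d) 𝓘(ℝ, ℝ) ∞ c) (hf : ContMDiff (𝓡∂ d) 𝓘(ℝ, V) ∞ f) (y : M) (w : Coord d) :
    diffAt (V := V) (fun y => c y • f y) y w =
      c y • diffAt (V := V) f y w + diffAt c y w • f y := by
  have h1 := hasMFDerivAt_diffAt hc y
  have h2 := hasMFDerivAt_diffAt hf y
  have h3 : HasMFDerivAt (𝓡∂ d) 𝓘(ℝ, V) (fun y => c y • f y) y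
      (c y • diffAt (d := d) (V := V) f y + (diffAt (d := d) c y).smulRight (f y)) := by
    refine ⟨h1.1.smul h2.1, ?_⟩
    have := h1.2.fun_smul h2.2
    have e1 : writtenInExtChartAt (𝓡∂ d) 𝓘(ℝ, ℝ) y c (extChartAt (𝓡∂ d) y y) = c y :=
      congrArg c ((extChartAt (𝓡∂ d) y).left_inv (mem_extChartAt_source y))
    have e2 : writtenInExtChartAt (𝓡∂ d) 𝓘(ℝ, V) y f (extChartAt (𝓡∂ d) y y) = f y :=
      congrArg f ((extChartAt (𝓡∂ d) y).left_inv (mem_extChartAt_source y))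
    rw [e1, e2] at this
    exact this
  have h4 := h3.mfderiv
  have h5 : diffAt (d := d) (V := V) (fun y => c y • f y) y =
    c y • diffAt (d := d) (V := V) f y + (diffAt (d := d) c y).smulRight (f y) := h4
  rw [h5]
  simp

/-- The chain rule for a function along a curve. -/
theorem hasDerivWithinAt_comp_curve {V : Type*} [NormedAddCommGroup V] [NormedSpace ℝ V]
    {f : M → V} (hf : ContMDiff (𝓡∂ d) 𝓘(ℝ, V) ∞ f) {γ : ℝ → M} {J : Set ℝ} {t : ℝ}
    (hγ : ContMDiffWithinAt 𝓘(ℝ, ℝ) (𝓡∂ d) ∞ γ J t) :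
    HasDerivWithinAt (fun s => f (γ s))
      (diffAt (V := V) f (γ t) (velocity γ J t : Coord d)) J t := by
  have h := (hasMFDerivAt_diffAt hf (γ t)).comp_hasMFDerivWithinAt t
    (hγ.mdifferentiableWithinAt (by simp)).hasMFDerivWithinAt
  have h2 : HasFDerivWithinAt (fun s => f (γ s)) ((diffAt (V := V) f (γ t)).comp
      (show ℝ →L[ℝ] Coord d from mfderivWithin 𝓘(ℝ, ℝ) (𝓡∂ d) γ J t)) J t :=
    hasMFDerivWithinAt_iff_hasFDerivWithinAt.1 h
  exact h2.hasDerivWithinAt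

variable [IsManifold (𝓡∂ d) ∞ M]

theorem riemExp_of_flowsTo {g : Metric d M} {x : M} {η : Coord d} {s : ℝ} {y : M}
    (h : FlowsTo g (fun _ => 0) (tangentPoint x η) s y) : RiemExp g x (s • η : Coord d) y := by
  rcases h with ⟨rfl, hy⟩ | ⟨hs, σ, hσ, hp, hy⟩
  · refine ⟨fun _ => x, ⟨contMDiffOn_const, fun t ht z hz k => ?_⟩, ?_, hy.symm⟩
    · have h0 : coordCurve d z (fun _ : ℝ => x) = fun _ => extChartAt (𝓡∂ d) z x := rfl
      have h1 : derivWithin (coordCurve d z (fun _ : ℝ => x)) (Icc 0 1) = 0 := by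
        rw [h0]; ext1 t; simp
      have h2 : gradComp g (fun _ => (0 : ℝ)) z k (coordCurve d z (fun _ => x) t) = 0 := by
        simp [gradComp, pd]
      rw [h1, h2]
      simp
    · refine lift_eq_tangentPoint_iff.2 ⟨rfl, ?_⟩
      unfold velocity
      rw [mfderivWithin_const]
      simp
      rfl
  · have hm : MapsTo (fun a => s * a) (Icc 0 1) (Icc 0 s) := fun a ha =>
      ⟨mul_nonneg hs.le ha.1, mul_le_of_le_one_right hs.le ha.2⟩
    refine ⟨σ ∘ fun a => s * a, IsGeodesicOn.comp_mul hσ (uniqueDiffOn_Icc hs)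
      (uniqueDiffOn_Icc zero_lt_one) hm, ?_, by simp [hy]⟩
    obtain ⟨hx, hξ⟩ := lift_eq_tangentPoint_iff.1 hp
    refine lift_eq_tangentPoint_iff.2 ⟨by simp [hx], ?_⟩
    have h0 : (0 : ℝ) ∈ Icc 0 s := left_mem_Icc.2 hs.le
    have hd : HasDerivWithinAt (fun a : ℝ => s * a) s (Icc 0 1) 0 := by
      simpa using (hasDerivWithinAt_id 0 (Icc (0 : ℝ) 1)).const_mul s
    rw [velocity_comp (uniqueDiffOn_Icc zero_lt_one 0 (left_mem_Icc.2 zero_le_one)) ?_ hd hm]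
    · simp [hξ]
    · simpa using (hσ.1 0 h0).mdifferentiableWithinAt (by simp)

theorem flowsTo_of_riemExp {g : Metric d M} {x : M} {v : Coord d} {y : M} {ℓ : ℝ} (hℓ : 0 < ℓ)
    (h : RiemExp g x v y) : FlowsTo g (fun _ => 0) (tangentPoint x (ℓ⁻¹ • v)) ℓ y := by
  obtain ⟨σ, hσ, hp, hy⟩ := h
  have hm : MapsTo (fun a => ℓ⁻¹ * a) (Icc 0 ℓ) (Icc 0 1) := fun a ha =>
    ⟨mul_nonneg (inv_pos.2 hℓ).le ha.1, by rw [inv_mul_le_iff₀ hℓ, mul_one]; exact ha.2⟩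
  refine Or.inr ⟨hℓ, σ ∘ fun a => ℓ⁻¹ * a, hσ.comp_mul (uniqueDiffOn_Icc zero_lt_one)
      (uniqueDiffOn_Icc hℓ) hm, ?_, by simp [inv_mul_cancel₀ hℓ.ne', hy]⟩
  obtain ⟨hx, hξ⟩ := lift_eq_iff.1 hp
  refine lift_eq_tangentPoint_iff.2 ⟨by simp [hx], ?_⟩
  have hd : HasDerivWithinAt (fun a : ℝ => ℓ⁻¹ * a) ℓ⁻¹ (Icc 0 ℓ) 0 := by
    simpa using (hasDerivWithinAt_id 0 (Icc (0 : ℝ) ℓ)).const_mul ℓ⁻¹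
  rw [velocity_comp (uniqueDiffOn_Icc hℓ 0 (left_mem_Icc.2 hℓ.le)) ?_ hd hm]
  · rw [mul_zero, hξ]
  · simpa using (hσ.1 0 (left_mem_Icc.2 zero_le_one)).mdifferentiableWithinAt (by simp)

/-- Geodesics with zero initial velocity are constant: by conservation of energy, the velocity
vanishes, and an injective smooth map to a vector space is constant along the curve. -/
theorem eq_of_riemExp_zero {g : Metric d M} {x : M} {y : M} (h : RiemExp g x (0 : Coord d) y)
    {G : M → Coord d} (hG : ContMDiff (𝓡∂ d) 𝓘(ℝ, Coord d) ∞ G) (hinj : Function.Injective G) :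
    y = x := by
  obtain ⟨σ, hσ, hp, rfl⟩ := h
  obtain ⟨hx, hξ⟩ := lift_eq_iff.1 hp
  have hξ' : velocity σ (Icc 0 1) 0 = (0 : Coord d) := hξ
  have hv : ∀ t ∈ Icc (0 : ℝ) 1, velocity σ (Icc 0 1) t = (0 : Coord d) := by
    intro t ht
    have h1 := energy_lift_eq (contMDiff_const (c := (0 : ℝ))) zero_lt_one hσ ht
    have h2 : (1 / 2) * innerAt g (σ t) (velocity σ (Icc 0 1) t) (velocity σ (Icc 0 1) t) + 0 =
      (1 / 2) * innerAt g (σ 0) (velocity σ (Icc 0 1) 0) (velocity σ (Icc 0 1) 0) + 0 := h1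
    rw [hξ'] at h2
    by_contra hne
    have := innerAt_pos g (σ t) hne
    simp at h2
    exact this.ne' h2
  have hd : ∀ t ∈ Icc (0 : ℝ) 1, HasDerivWithinAt (fun s => G (σ s)) 0 (Icc 0 1) t := fun t ht => by
    have := hasDerivWithinAt_comp_curve hG (hσ.1 t ht)
    rwa [hv t ht, map_zero] at this
  have hconst := constant_of_derivWithin_zero (fun t ht => (hd t ht).differentiableWithinAt)
    (fun t ht => (hd t (Ico_subset_Icc_self ht)).derivWithin
      (uniqueDiffOn_Icc zero_lt_one t (Ico_subset_Icc_self ht))) 1 (right_mem_Icc.2 zero_le_one)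
  rw [← hx]
  exact hinj hconst

end PotentialRay

namespace PotentialRay
variable {d : ℕ} [NeZero d] {M : Type*} [TopologicalSpace M]
  [ChartedSpace (EuclideanHalfSpace d) M]

/-! ### Smooth maps from the manifold to the model space -/

/-- Half balls are compact convex neighbourhoods with unique derivatives. -/
theorem exists_halfBall (y₀ : M) : ∃ K ⊆ (extChartAt (𝓡∂ d) y₀).target, IsCompact K ∧ Convex ℝ K ∧
    UniqueDiffOn ℝ K ∧ extChartAt (𝓡∂ d) y₀ y₀ ∈ K ∧
      K ∈ nhdsWithin (extChartAt (𝓡∂ d) y₀ y₀) (range (𝓡∂ d)) := by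
  set u₀ := extChartAt (𝓡∂ d) y₀ y₀ with hu₀
  have hmem : u₀ ∈ range (𝓡∂ d) := extChartAt_target_subset_range y₀ (mem_extChartAt_target y₀)
  obtain ⟨r, hr, hsub⟩ := (nhdsWithin_hasBasis _root_.Metric.nhds_basis_closedBall
    (range (𝓡∂ d))).mem_iff.1 (extChartAt_target_mem_nhdsWithin (I := 𝓡∂ d) y₀)
  have hconv : Convex ℝ (Metric.closedBall u₀ r ∩ range (𝓡∂ d)) :=
    (convex_closedBall u₀ r).inter (𝓡∂ d).convex_range
  refine ⟨Metric.closedBall u₀ r ∩ range (𝓡∂ d), hsub,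
    (isCompact_closedBall u₀ r).inter_right (𝓡∂ d).isClosed_range, hconv,
    uniqueDiffOn_convex hconv ?_, ⟨Metric.mem_closedBall_self hr.le, hmem⟩, ?_⟩
  · rw [interior_inter]
    obtain ⟨w, hw1, hw2⟩ := mem_closure_iff.1 ((𝓡∂ d).range_subset_closure_interior hmem) _
      Metric.isOpen_ball (Metric.mem_ball_self hr)
    exact ⟨w, Metric.ball_subset_interior_closedBall hw1, hw2⟩
  · rw [inter_comm]
    exact inter_mem_nhdsWithin _ (Metric.closedBall_mem_nhds u₀ hr)

/-- A map with a left inverse that is smooth on a set containing the image is an immersion. -/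
theorem diffAt_injective_of_leftInverse {F : Coord d → M} {G : M → Coord d} {D : Set (Coord d)}
    (hF : ContMDiffOn 𝓘(ℝ, Coord d) (𝓡∂ d) ∞ F D) (hG : ContMDiff (𝓡∂ d) 𝓘(ℝ, Coord d) ∞ G)
    (hD : ∀ y, G y ∈ D) (hFG : ∀ y, F (G y) = y) (y : M) :
    Function.Injective (diffAt (d := d) (V := Coord d) G y) := by
  have h1 := ((hF _ (hD y)).mdifferentiableWithinAt (by simp)).hasMFDerivWithinAt
  have h2 := hasMFDerivAt_diffAt hG y
  have h3 := HasMFDerivWithinAt.comp (u := D) y h1 (hasMFDerivWithinAt_univ.2 h2)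
    (fun z _ => hD z)
  rw [hasMFDerivWithinAt_univ, show F ∘ G = id from funext hFG] at h3
  have h4 := hasMFDerivAt_unique h3 (hasMFDerivAt_id y)
  refine (injective_iff_map_eq_zero _).2 fun w hw => ?_
  have h5 := DFunLike.congr_fun h4 w
  have h6 : (mfderivWithin 𝓘(ℝ, Coord d) (𝓡∂ d) F D (G y)) (diffAt (V := Coord d) G y w) = w := h5
  rw [hw] at h6
  rw [← h6]
  exact map_zero _

variable [IsManifold (𝓡∂ d) ∞ M]

theorem contMDiff_integral_ray {D : Set (Coord d)} {k : Coord d → ℝ} {G : M → Coord d}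
    (hk : ContDiffOn ℝ ∞ k D) (hG : ContMDiff (𝓡∂ d) 𝓘(ℝ, Coord d) ∞ G)
    (hD : ∀ y, ∀ a ∈ Icc (0 : ℝ) 1, a • G y ∈ D) :
    ContMDiff (𝓡∂ d) 𝓘(ℝ, ℝ) ∞ fun y => ∫ a in (0 : ℝ)..1, k (a • G y) := by
  intro y₀
  obtain ⟨K, hKT, hKc, hKconv, hKu, hK0, hKn⟩ := exists_halfBall (d := d) y₀
  have hGK : ContDiffOn ℝ ∞ (fun u => G ((extChartAt (𝓡∂ d) y₀).symm u)) K := by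
    rw [← contMDiffOn_iff_contDiffOn]
    exact (hG.comp_contMDiffOn (contMDiffOn_extChartAt_symm y₀)).mono hKT
  have hf : ContDiffOn ℝ ∞ (fun p : ℝ × Coord d =>
      k (p.1 • G ((extChartAt (𝓡∂ d) y₀).symm p.2))) (Icc 0 1 ×ˢ K) := by
    refine hk.comp (contDiff_fst.contDiffOn.smul (hGK.comp contDiff_snd.contDiffOn
      fun p hp => hp.2)) fun p hp => hD _ _ hp.1
  rw [contMDiffAt_iff_source]
  have : ContDiffOn ℝ ∞ (fun u => ∫ a in (0 : ℝ)..1,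
      k (a • G ((extChartAt (𝓡∂ d) y₀).symm u))) K := by
    rw [contDiffOn_infty] at hf ⊢
    exact fun n => contDiffOn_intervalIntegral_nat hKc hKconv hKu n (hf n)
  exact ((this _ hK0).mono_of_mem_nhdsWithin hKn).contMDiffWithinAt

theorem fderivWithin_comp_symm {G : M → Coord d} (hG : ContMDiff (𝓡∂ d) 𝓘(ℝ, Coord d) ∞ G)
    (z : M) {u : Coord d} (hu : u ∈ (extChartAt (𝓡∂ d) z).target) :
    fderivWithin ℝ (fun u => G ((extChartAt (𝓡∂ d) z).symm u)) (extChartAt (𝓡∂ d) z).target u =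
      (diffAt (V := Coord d) G ((extChartAt (𝓡∂ d) z).symm u)).comp (chartSymmDeriv z u) := by
  have h1 := (mdifferentiableWithinAt_extChartAt_symm (I := 𝓡∂ d) hu).hasMFDerivWithinAt
  have h2 := (hasMFDerivAt_diffAt hG ((extChartAt (𝓡∂ d) z).symm u)).comp_hasMFDerivWithinAt u h1
  have h3 : HasFDerivWithinAt (fun u => G ((extChartAt (𝓡∂ d) z).symm u))
      ((diffAt (V := Coord d) G ((extChartAt (𝓡∂ d) z).symm u)).comp (chartSymmDeriv z u))
      (range (𝓡∂ d)) u := hasMFDerivWithinAt_iff_hasFDerivWithinAt.1 h2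
  exact (h3.mono (extChartAt_target_subset_range z)).fderivWithin
    (uniqueDiffOn_extChartAt_target z u hu)

/-- The inverse of an injective immersion of a compact manifold into the model space is smooth on
the image. -/
theorem contMDiffOn_leftInverse_of_immersion [CompactSpace M] {F : Coord d → M} {G : M → Coord d}
    (hG : ContMDiff (𝓡∂ d) 𝓘(ℝ, Coord d) ∞ G)
    (himm : ∀ y, Function.Injective (diffAt (d := d) (V := Coord d) G y)) (hFG : ∀ y, F (G y) = y) :
    ContMDiffOn 𝓘(ℝ, Coord d) (𝓡∂ d) ∞ F (range G) := by
  have hinj : Function.Injective G := Function.LeftInverse.injective hFG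
  have hemb := (hG.continuous.isClosedEmbedding hinj).isEmbedding
  have hFc : ContinuousOn F (range G) := by
    rintro _ ⟨y, rfl⟩
    rw [ContinuousWithinAt, ← hemb.map_nhds_eq, Filter.tendsto_map'_iff, hFG]
    exact Filter.tendsto_id.congr fun z => (hFG z).symm
  rintro _ ⟨y₀, rfl⟩
  set U := F ⁻¹' (extChartAt (𝓡∂ d) y₀).source ∩ range G with hU
  have hUn : U ∈ nhdsWithin (G y₀) (range G) := by
    refine Filter.inter_mem ((hFc _ (mem_range_self y₀)).preimage_mem_nhdsWithin ?_)
      self_mem_nhdsWithin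
    rw [hFG]
    exact extChartAt_source_mem_nhds y₀
  have hU0 : G y₀ ∈ U := mem_of_mem_nhdsWithin (mem_range_self y₀) hUn
  have hφ : ContDiffOn ℝ ∞ (fun u => G ((extChartAt (𝓡∂ d) y₀).symm u))
      (extChartAt (𝓡∂ d) y₀).target := by
    rw [← contMDiffOn_iff_contDiffOn]
    exact hG.comp_contMDiffOn (contMDiffOn_extChartAt_symm y₀)
  have hf : ContDiffOn ℝ ∞ (fun v => extChartAt (𝓡∂ d) y₀ (F v)) U := by
    refine contDiffOn_of_leftInverse (uniqueDiffOn_extChartAt_target y₀) hφ (fun u hu => ?_) ?_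
      (fun v hv => (extChartAt (𝓡∂ d) y₀).map_source hv.1) ?_
    · rw [fderivWithin_comp_symm hG y₀ hu]
      have hi : Function.Injective ((diffAt (V := Coord d) G
          ((extChartAt (𝓡∂ d) y₀).symm u)).comp (chartSymmDeriv y₀ u)) :=
        (himm _).comp (chartSymmDeriv_injective y₀ hu)
      exact ⟨(LinearEquiv.ofInjectiveEndo _ hi).toContinuousLinearEquiv, by ext1 v; rfl⟩
    · exact (continuousOn_extChartAt y₀).comp (hFc.mono inter_subset_right) fun v hv => hv.1
    · rintro v ⟨hv, y, rfl⟩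
      rw [(extChartAt (𝓡∂ d) y₀).left_inv hv, hFG]
  rw [contMDiffWithinAt_iff_target]
  refine ⟨hFc _ ⟨y₀, rfl⟩, ?_⟩
  rw [hFG]
  exact ((hf _ hU0).mono_of_mem_nhdsWithin hUn).contMDiffWithinAt

/-! ### The exponential map of the Jacobi metric -/

section Exponential
variable {g g' : Metric d M} {q : M → ℝ} {H₀ : ℝ}

/-- The Riemannian exponential map of `2 (H₀ - q) g` is a diffeomorphism onto `M`. -/
theorem isDiffeoOnto_riemExp [CompactSpace M] (hq : ContMDiff (𝓡∂ d) 𝓘(ℝ, ℝ) ∞ q)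
    (hg : ∀ x v w, innerAt g' x v w = jacobiFactor q H₀ x * innerAt g x v w)
    (hs : ∀ x : M, IsDiffeoOnto x (HExp g q H₀ x)) (x : M) :
    IsDiffeoOnto x (RiemExp g' x) := by
  have hpos := jacobiFactor_pos hs
  have hρ : ContMDiff (𝓡∂ d) 𝓘(ℝ, ℝ) ∞ (jacobiFactor q H₀) := contMDiff_jacobiFactor hq
  obtain ⟨F, G, hFs, hGs, hF, hG⟩ := hs x
  set ρ : M → ℝ := jacobiFactor q H₀ with hρdef
  set D : Set (Coord d) := {v | ∃ y, HExp g q H₀ x v y} with hD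
  have hR : ∀ y, HExp g q H₀ x (G y) y := fun y => (hG _ y).2 rfl
  have hGD : ∀ y, G y ∈ D := fun y => ⟨y, hR y⟩
  have hFG : ∀ y, F (G y) = y := fun y => hF _ _ (hR y)
  have hGinj : Function.Injective G := Function.LeftInverse.injective hFG
  have hray : ∀ (ξ : Coord d) (t : ℝ) (y : M), innerAt g x ξ ξ = ρ x →
      FlowsTo g q (tangentPoint x ξ) t y → G y = t • ξ := fun ξ t y hξ h =>
    (hG _ _).1 (hExp_iff.2 ⟨t, ξ, h.nonneg, hξ, rfl, h⟩)
  have hGy : ∀ y, ∃ (t : ℝ) (ξ : Coord d), 0 ≤ t ∧ innerAt g x ξ ξ = ρ x ∧ G y = t • ξ ∧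
      FlowsTo g q (tangentPoint x ξ) t y := fun y => hExp_iff.1 (hR y)
  -- The domain of `exp_x^H` is star-shaped.
  have hstar : ∀ y, ∀ a ∈ Icc (0 : ℝ) 1, a • G y ∈ D := by
    intro y a ha
    obtain ⟨t, ξ, ht, hξ, hv, hf⟩ := hGy y
    have hat : a * t ∈ Icc 0 t := ⟨mul_nonneg ha.1 ht, mul_le_of_le_one_left ht ha.2⟩
    obtain ⟨y', hy'⟩ := hf.of_le hat
    exact ⟨y', hExp_iff.2 ⟨a * t, ξ, hat.1, hξ, by rw [hv, smul_smul], hy'⟩⟩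
  have hk : ContDiffOn ℝ ∞ (fun v => ρ (F v)) D := by
    rw [← contMDiffOn_iff_contDiffOn]
    exact hρ.comp_contMDiffOn hFs
  -- The time change of the trajectory from `x` to `y` multiplies `G y` by the factor `c y`.
  set c : M → ℝ := fun y => (ρ x)⁻¹ * ∫ a in (0 : ℝ)..1, ρ (F (a • G y)) with hc
  have hcs : ContMDiff (𝓡∂ d) 𝓘(ℝ, ℝ) ∞ c :=
    contMDiff_const.mul (contMDiff_integral_ray hk hGs hstar)
  have hcpos : ∀ y, 0 < c y := by
    intro y
    refine mul_pos (inv_pos.2 (hpos x)) ?_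
    have hcont : ContinuousOn (fun a : ℝ => ρ (F (a • G y))) (Icc 0 1) :=
      hk.continuousOn.comp (by fun_prop) fun a ha => hstar y a ha
    exact intervalIntegral.intervalIntegral_pos_of_pos_on
      (hcont.intervalIntegrable_of_Icc zero_le_one) (fun a _ => hpos _) zero_lt_one
  set G' : M → Coord d := fun y => c y • G y with hG'
  have hG's : ContMDiff (𝓡∂ d) 𝓘(ℝ, Coord d) ∞ G' := hcs.smul hGs
  have hG'ray : ∀ (ξ : Coord d) (t : ℝ) (y : M), innerAt g x ξ ξ = ρ x →
      FlowsTo g q (tangentPoint x ξ) t y →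
        G' y = jacobiTime g q H₀ (tangentPoint x ξ) t • (ρ x)⁻¹ • ξ := by
    intro ξ t y hξ h
    have h1 : ∀ a ∈ Icc (0 : ℝ) 1,
        ρ (F (a • G y)) = ρ (flowPoint g q (tangentPoint x ξ) (a * t)) := by
      intro a ha
      have hat : a * t ∈ Icc 0 t :=
        ⟨mul_nonneg ha.1 h.nonneg, mul_le_of_le_one_left h.nonneg ha.2⟩
      obtain ⟨y', hy'⟩ := h.of_le hat
      rw [flowPoint_eq_of_flowsTo hs hξ hy', hray ξ t y hξ h, smul_smul, ← hray ξ _ y' hξ hy', hFG]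
    have h2 : ∫ a in (0 : ℝ)..1, ρ (F (a • G y)) =
        ∫ a in (0 : ℝ)..1, ρ (flowPoint g q (tangentPoint x ξ) (a * t)) := by
      refine intervalIntegral.integral_congr fun a ha => ?_
      rw [uIcc_of_le zero_le_one] at ha
      exact h1 a ha
    have h3 := intervalIntegral.mul_integral_comp_mul_right (a := 0) (b := 1)
      (f := fun u => ρ (flowPoint g q (tangentPoint x ξ) u)) t
    rw [zero_mul, one_mul] at h3
    simp only [hG', hc]
    rw [h2, hray ξ t y hξ h, jacobiTime, ← h3, smul_smul, smul_smul]
    congr 1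
    ring
  -- Nonzero vectors are multiples of `g'`-unit vectors, whose geodesics are reparametrizations of
  -- trajectories of energy `H₀`.
  have hunit : ∀ v : Coord d, v ≠ 0 → ∃ (ℓ : ℝ) (ξ : Coord d), innerAt g x ξ ξ = ρ x ∧
      v = ℓ • (ρ x)⁻¹ • ξ ∧ ∀ y, RiemExp g' x v y →
        FlowsTo g' (fun _ => 0) (tangentPoint x ((ρ x)⁻¹ • ξ)) ℓ y := by
    intro v hv
    have hℓ : 0 < √(innerAt g' x v v) := Real.sqrt_pos.2 (innerAt_pos g' x hv)
    set ℓ := √(innerAt g' x v v) with hℓdef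
    have hsq : ℓ ^ 2 = innerAt g' x v v := Real.sq_sqrt (innerAt_self_nonneg g' x v)
    refine ⟨ℓ, ρ x • ℓ⁻¹ • v, ?_, ?_, fun y h => ?_⟩
    · have := hg x v v
      have hp := (hpos x).ne'
      simp only [map_smul, smul_apply, smul_eq_mul]
      rw [← hsq] at this
      field_simp
      linarith
    · rw [inv_smul_smul₀ (hpos x).ne', smul_inv_smul₀ hℓ.ne']
    · rw [inv_smul_smul₀ (hpos x).ne']
      exact flowsTo_of_riemExp hℓ h
  -- The relation between the two exponential maps.
  have hiff : ∀ (v : Coord d) (y : M), RiemExp g' x v y ↔ G' y = v := by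
    intro v y
    constructor
    · intro h
      by_cases hv : v = 0
      · subst hv
        have hyx := eq_of_riemExp_zero h hGs hGinj
        obtain ⟨t, ξ, ht, hξ, -, -⟩ := hGy y
        have : G y = 0 := by
          rw [hray ξ 0 y hξ (Or.inl ⟨rfl, hyx⟩), zero_smul]
        simp only [hG', this, smul_zero]
      · obtain ⟨ℓ, ξ, hξ, hv', h1⟩ := hunit v hv
        obtain ⟨t, ht, hst⟩ := (flowsTo_jacobi_iff hq hg hs hξ).1 (h1 y h)
        rw [hG'ray _ t y hξ ht, ← hst, hv']
    · rintro rfl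
      obtain ⟨t, ξ, ht, hξ, -, hf⟩ := hGy y
      rw [hG'ray ξ t y hξ hf]
      exact riemExp_of_flowsTo ((flowsTo_jacobi_iff hq hg hs hξ).2 ⟨t, hf, rfl⟩)
  -- `G'` is an immersion: a kernel vector would be a multiple of the velocity of the trajectory,
  -- along which `G'` has the derivative `2 (H₀ - q) ξ / (2 (H₀ - q(x)))`.
  have hGimm := diffAt_injective_of_leftInverse hFs hGs hGD hFG
  have himm : ∀ y, Function.Injective (diffAt (d := d) (V := Coord d) G' y) := by
    intro y
    refine (injective_iff_map_eq_zero _).2 fun w hw => ?_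
    have hsm : diffAt (V := Coord d) G' y w = c y • diffAt (V := Coord d) G y w +
      diffAt (V := ℝ) c y w • G y := diffAt_smul hcs hGs y w
    rw [hw] at hsm
    obtain ⟨t, ξ, ht, hξ, hv, hf⟩ := hGy y
    have hξ0 : ξ ≠ 0 := by
      rintro rfl
      simp at hξ
      exact (hpos x).ne hξ
    have hprops := jacobiTime_props hq hs hξ ht hf
    rcases hf with ⟨rfl, -⟩ | ⟨ht0, γ, hγ, hp, hy⟩
    · rw [hv, zero_smul, smul_zero, add_zero] at hsm
      have := (smul_eq_zero.1 hsm.symm).resolve_left (hcpos y).ne'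
      exact hGimm y (this.trans (map_zero _).symm)
    · have htm : t ∈ Icc 0 t := right_mem_Icc.2 ht
      have hU := uniqueDiffOn_Icc ht0 t htm
      have hflow : ∀ u ∈ Icc 0 t, FlowsTo g q (tangentPoint x ξ) u (γ u) :=
        fun u hu => hγ.flowsTo ht0 hp hu
      set w₀ : Coord d := velocity γ (Icc 0 t) t with hw₀
      have h1 : diffAt (V := Coord d) G y w₀ = ξ := by
        have ha := hasDerivWithinAt_comp_curve hGs (hγ.1 t htm)
        rw [hy] at ha
        have hb : HasDerivWithinAt (fun u => G (γ u)) ξ (Icc 0 t) t := by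
          have : HasDerivWithinAt (fun u : ℝ => u • ξ) ((1 : ℝ) • ξ) (Icc 0 t) t :=
            (hasDerivWithinAt_id t _).smul_const ξ
          rw [one_smul] at this
          exact this.congr (fun u hu => hray ξ u _ hξ (hflow u hu)) (hray ξ t _ hξ (hflow t htm))
        rw [← ha.derivWithin hU, hb.derivWithin hU]
      have h2 : diffAt (V := Coord d) G' y w₀ = (ρ y * (ρ x)⁻¹) • ξ := by
        have ha := hasDerivWithinAt_comp_curve hG's (hγ.1 t htm)
        rw [hy] at ha
        have hb : HasDerivWithinAt (fun u => G' (γ u)) ((ρ y * (ρ x)⁻¹) • ξ) (Icc 0 t) t := by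
          have h3 := (hprops.2.2 t htm).smul_const ((ρ x)⁻¹ • ξ)
          rw [flowPoint_eq_of_flowsTo hs hξ (hflow t htm), hy, smul_smul] at h3
          exact h3.congr (fun u hu => hG'ray ξ u _ hξ (hflow u hu)) (hG'ray ξ t _ hξ (hflow t htm))
        rw [← ha.derivWithin hU, hb.derivWithin hU]
      set μ : ℝ := -((c y)⁻¹ * (diffAt (V := ℝ) c y w * t)) with hμ
      have h4 : w = μ • w₀ := by
        apply hGimm y
        rw [map_smul, h1]
        have h5 : c y • diffAt (V := Coord d) G y w = -((diffAt (V := ℝ) c y w * t) • ξ) := by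
          rw [hv, smul_smul] at hsm
          exact eq_neg_of_add_eq_zero_left hsm.symm
        rw [← inv_smul_smul₀ (hcpos y).ne' (diffAt (V := Coord d) G y w), h5, smul_neg, smul_smul,
          hμ, neg_smul]
      have h6 : (μ * (ρ y * (ρ x)⁻¹)) • ξ = 0 := by
        rw [← smul_smul, ← h2, ← map_smul, ← h4, hw]
      have h7 : μ = 0 := by
        have h8 := (smul_eq_zero.1 h6).resolve_right hξ0
        exact (mul_eq_zero.1 h8).resolve_right
          (mul_pos (hpos y) (inv_pos.2 (hpos x))).ne'
      rw [h4, h7, zero_smul]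
  have hG'inj : Function.Injective G' := by
    intro y y' h
    have h1 := (hiff _ y).2 rfl
    have h2 := (hiff _ y').2 h.symm
    by_cases hv : G' y = 0
    · rw [hv] at h1 h2
      rw [eq_of_riemExp_zero h1 hGs hGinj, eq_of_riemExp_zero h2 hGs hGinj]
    · obtain ⟨ℓ, ξ, hξ, -, hfl⟩ := hunit _ hv
      exact flowsTo_jacobi_unique hq hg hs hξ (hfl y h1) (hfl y' h2)
  have : Nonempty M := ⟨x⟩
  have hF'G' : ∀ y, Function.invFun G' (G' y) = y := Function.leftInverse_invFun hG'inj
  have hdom : {v : Coord d | ∃ y, RiemExp g' x v y} = range G' := by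
    ext v
    exact exists_congr fun y => hiff v y
  refine ⟨Function.invFun G', G', ?_, hG's, fun v y h => ?_, hiff⟩
  · have := contMDiffOn_leftInverse_of_immersion hG's himm hF'G'
    rwa [← hdom] at this
  · rw [← (hiff v y).1 h, hF'G']

end Exponential

end PotentialRay

namespace PotentialRay
variable {d : ℕ} [NeZero d] {M : Type*} [TopologicalSpace M]
  [ChartedSpace (EuclideanHalfSpace d) M] [IsManifold (𝓡∂ d) ∞ M]

/-! ### Conformal metrics and the boundary -/

/-- The metric `κ g`, for a positive smooth function `κ`. -/
noncomputable def conformalMetric (g : Metric d M) (κ : M → ℝ)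
    (hκ : ContMDiff (𝓡∂ d) 𝓘(ℝ, ℝ) ∞ κ) (hpos : ∀ x, 0 < κ x) : Metric d M where
  inner x := κ x • g.inner x
  symm x v w := congrArg (κ x * ·) (g.symm x v w)
  pos x v hv := mul_pos (hpos x) (g.pos x v hv)
  isVonNBounded x := by
    -- The unit ball of `κ g` is the image of that of `g` under the multiplication by `1 / √κ`.
    have h := (g.isVonNBounded x).image
      ((√(κ x))⁻¹ • ContinuousLinearMap.id ℝ (TangentSpace (𝓡∂ d) x))
    have hs : √(κ x) ≠ 0 := (Real.sqrt_pos.2 (hpos x)).ne'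
    refine h.subset fun v hv => (mem_image _ _ _).2 ⟨√(κ x) • v, ?_, ?_⟩
    · have h1 : g.inner x (√(κ x) • v) (√(κ x) • v) = κ x * g.inner x v v := by
        simp only [map_smul, smul_apply, smul_eq_mul]
        rw [← mul_assoc, Real.mul_self_sqrt (hpos x).le]
      exact (h1.trans_lt hv : g.inner x (√(κ x) • v) (√(κ x) • v) < 1)
    · simp [smul_smul, mul_inv_cancel₀ hs]
  contMDiff := hκ.smul_section g.contMDiff

theorem innerAt_conformalMetric (g : Metric d M) (κ : M → ℝ)
    (hκ : ContMDiff (𝓡∂ d) 𝓘(ℝ, ℝ) ∞ κ) (hpos : ∀ x, 0 < κ x) (x : M) (v w : Coord d) :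
    innerAt (conformalMetric g κ hκ hpos) x v w = κ x * innerAt g x v w := rfl

/-- At the centre of a chart, the inner product is given by the Gram matrix. -/
theorem innerAt_eq_dotProduct (g : Metric d M) (x : M) (v w : Coord d) :
    innerAt g x v w = v.ofLp ⬝ᵥ gram g x (extChartAt (𝓡∂ d) x x) *ᵥ w.ofLp := by
  have h := gram_dotProduct g x (extChartAt (𝓡∂ d) x x) v w
  have hid : chartSymmDeriv x (extChartAt (𝓡∂ d) x x) = ContinuousLinearMap.id ℝ (Coord d) :=
    mfderivWithin_range_extChartAt_symm
  rw [(extChartAt (𝓡∂ d) x).left_inv (mem_extChartAt_source x), hid] at h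
  simp only [ContinuousLinearMap.id_apply] at h
  rw [← h]
  simp only [dotProduct, Matrix.mulVec, Finset.mul_sum]
  exact Finset.sum_congr rfl fun i _ => Finset.sum_congr rfl fun j _ => by ring

theorem gram_inv_zero_pos (g : Metric d M) (x : M) :
    0 < (gram g x (extChartAt (𝓡∂ d) x x))⁻¹ 0 0 :=
  (gram_posDef g x (mem_extChartAt_target x)).inv.diag_pos

theorem gram_inv_symm (g : Metric d M) (x : M) (k l : Fin d) :
    (gram g x (extChartAt (𝓡∂ d) x x))⁻¹ k l = (gram g x (extChartAt (𝓡∂ d) x x))⁻¹ l k := by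
  have := (gram_posDef g x (mem_extChartAt_target x)).inv.isHermitian.apply l k
  simpa using this

/-- The inner product with the normal vector reads off the zeroth coordinate. -/
theorem innerAt_normal (g : Metric d M) (x : M) (v : Coord d) :
    innerAt g x v (normal g x) = v 0 / √((gram g x (extChartAt (𝓡∂ d) x x))⁻¹ 0 0) := by
  set B := (gram g x (extChartAt (𝓡∂ d) x x))⁻¹ with hB
  have hn : (show Coord d from normal g x).ofLp = (√(B 0 0))⁻¹ • (B *ᵥ Pi.single 0 1) := by
    ext k
    have h1 : (show Coord d from normal g x).ofLp k = B 0 k / √(B 0 0) := rfl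
    rw [h1, Pi.smul_apply, smul_eq_mul, Matrix.mulVec_single_one, Matrix.col_apply, hB,
      gram_inv_symm g x 0 k]
    ring
  have h := innerAt_eq_dotProduct g x v (normal g x)
  rw [h]
  have h2 : (gram g x (extChartAt (𝓡∂ d) x x)) *ᵥ (show Coord d from normal g x).ofLp =
      (√(B 0 0))⁻¹ • Pi.single 0 1 := by
    rw [hn, Matrix.mulVec_smul, hB, gram_mulVec_inv g x (mem_extChartAt_target x)]
  refine (congrArg (v.ofLp ⬝ᵥ ·) h2).trans ?_
  simp only [dotProduct_smul, dotProduct_single, mul_one, smul_eq_mul]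
  ring

/-- The second fundamental form is the normal component of `Γᵏᵢⱼ ξⁱ ξʲ`. -/
theorem secondFundamentalForm_self (g : Metric d M) (x : M) (ξ : Coord d) :
    secondFundamentalForm g x ξ ξ = ((gram g x (extChartAt (𝓡∂ d) x x))⁻¹ *ᵥ
      loweredChristoffel (chartMetricDeriv g x (extChartAt (𝓡∂ d) x x)) ξ.ofLp) 0 /
        √((gram g x (extChartAt (𝓡∂ d) x x))⁻¹ 0 0) := by
  have h := innerAt_normal g x (WithLp.toLp 2 fun k => ∑ i, ∑ j,
    christoffel g x k i j (extChartAt (𝓡∂ d) x x) * ξ i * ξ j : Coord d)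
  refine Eq.trans h ?_
  simp only [christoffel_contract]
  rfl

theorem mfderiv_normal (g : Metric d M) {q : M → ℝ} (hq : ContMDiff (𝓡∂ d) 𝓘(ℝ, ℝ) ∞ q) (x : M) :
    (show ℝ from mfderiv (𝓡∂ d) 𝓘(ℝ, ℝ) q x (normal g x)) =
      ((gram g x (extChartAt (𝓡∂ d) x x))⁻¹ *ᵥ chartGrad q x (extChartAt (𝓡∂ d) x x)) 0 /
        √((gram g x (extChartAt (𝓡∂ d) x x))⁻¹ 0 0) := by
  have hd : mfderiv (𝓡∂ d) 𝓘(ℝ, ℝ) q x =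
      fderivWithin ℝ (fun y => q ((extChartAt (𝓡∂ d) x).symm y)) (range (𝓡∂ d))
        (extChartAt (𝓡∂ d) x x) := by
    exact (hq.mdifferentiable (by simp) x).mfderiv
  have h2 := fderivWithin_eq_sum_pd (fun y => q ((extChartAt (𝓡∂ d) x).symm y))
    (extChartAt (𝓡∂ d) x x) (normal g x)
  rw [hd]
  refine Eq.trans h2 ?_
  simp only [Matrix.mulVec, dotProduct, Finset.sum_div]
  refine Finset.sum_congr rfl fun k _ => ?_
  have h1 : (show Coord d from normal g x).ofLp k = (gram g x (extChartAt (𝓡∂ d) x x))⁻¹ 0 k /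
    √((gram g x (extChartAt (𝓡∂ d) x x))⁻¹ 0 0) := rfl
  refine (congrArg (_ * ·) h1).trans ?_
  simp only [chartGrad]
  ring

section Jacobi
variable {g g' : Metric d M} {q : M → ℝ} {H₀ : ℝ}

/-- `H`-convexity of the boundary is convexity for the metric `2 (H₀ - q) g`. -/
theorem strictlyConvexBoundary_jacobi (hq : ContMDiff (𝓡∂ d) 𝓘(ℝ, ℝ) ∞ q)
    (hpos : ∀ x, 0 < jacobiFactor q H₀ x)
    (hg : ∀ x v w, innerAt g' x v w = jacobiFactor q H₀ x * innerAt g x v w)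
    (hconv : StrictlyHConvexBoundary g q H₀) : StrictlyConvexBoundary g' := by
  intro x hx ξ hξt hξ0
  have hρ : ContMDiff (𝓡∂ d) 𝓘(ℝ, ℝ) ∞ (jacobiFactor q H₀) := contMDiff_jacobiFactor hq
  have hy := mem_extChartAt_target (I := 𝓡∂ d) x
  have hsymm := (extChartAt (𝓡∂ d) x).left_inv (mem_extChartAt_source (I := 𝓡∂ d) x)
  change Coord d at ξ
  replace hξt : ξ 0 = 0 := hξt
  have hN : 0 < innerAt g x ξ ξ := innerAt_pos g x hξ0
  rw [secondFundamentalForm_self]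
  refine div_pos ?_ (Real.sqrt_pos.2 (gram_inv_zero_pos g' x))
  -- The hypothesis is applied to the multiple `s ξ` of energy `H₀`.
  set s := √(jacobiFactor q H₀ x / innerAt g x ξ ξ) with hs
  have hs2 : s ^ 2 = jacobiFactor q H₀ x / innerAt g x ξ ξ := Real.sq_sqrt (div_pos (hpos x) hN).le
  have h1 := hconv x hx (s • ξ : Coord d) (by
    change (s • ξ : Coord d) 0 = 0
    simp [hξt]) (energy_eq_iff.2 (by
      simp only [map_smul, smul_apply, smul_eq_mul]
      rw [← mul_assoc, ← sq, hs2, div_mul_cancel₀ _ hN.ne']))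
  rw [secondFundamentalForm_self, mfderiv_normal g hq, ← neg_div,
    div_lt_div_iff_of_pos_right (Real.sqrt_pos.2 (gram_inv_zero_pos g x)), WithLp.ofLp_smul,
    loweredChristoffel_smul, Matrix.mulVec_smul, Pi.smul_apply, smul_eq_mul, hs2] at h1
  have hK : chartGrad (jacobiFactor q H₀) x (extChartAt (𝓡∂ d) x x) =
      (-2 : ℝ) • chartGrad q x (extChartAt (𝓡∂ d) x x) := by
    ext l
    have hd := differentiableWithinAt_comp_symm hq x hy
    have hu := uniqueDiffWithinAt_range hy
    simp only [chartGrad, pd, jacobiFactor, Pi.smul_apply, smul_eq_mul]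
    rw [fderivWithin_const_mul hu (hd.const_sub _), fderivWithin_const_sub hu]
    simp only [smul_apply, neg_apply, smul_eq_mul]
    ring
  rw [christoffel_conformal hρ hpos hg x hy, hsymm, ← innerAt_eq_dotProduct, hK,
    Matrix.mulVec_smul]
  simp only [Pi.add_apply, Pi.smul_apply, Pi.sub_apply, smul_eq_mul, hξt]
  set a := ((gram g x (extChartAt (𝓡∂ d) x x))⁻¹ *ᵥ
    loweredChristoffel (chartMetricDeriv g x (extChartAt (𝓡∂ d) x x)) ξ.ofLp) 0
  set b := ((gram g x (extChartAt (𝓡∂ d) x x))⁻¹ *ᵥ chartGrad q x (extChartAt (𝓡∂ d) x x)) 0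
  set N := innerAt g x ξ ξ
  have hp := hpos x
  set ρ := jacobiFactor q H₀ x
  have h2 : a + ρ⁻¹ * (-2 * chartGrad q x (extChartAt (𝓡∂ d) x x) ⬝ᵥ ξ.ofLp * 0
      - 1 / 2 * N * (-2 * b)) = N / ρ * (ρ / N * a + b) := by
    field_simp
    ring
  have h3 : 0 < N / ρ * (ρ / N * a + b) := mul_pos (div_pos hN hp) (by linarith)
  rw [← h2] at h3
  simpa using h3

theorem inwardUnitBundle_of_inwardEnergyBundle (hpos : ∀ x, 0 < jacobiFactor q H₀ x)
    (hg : ∀ x v w, innerAt g' x v w = jacobiFactor q H₀ x * innerAt g x v w) {x : M} {ξ : Coord d}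
    (h : tangentPoint x ξ ∈ inwardEnergyBundle g q H₀) :
    tangentPoint x ((jacobiFactor q H₀ x)⁻¹ • ξ) ∈ inwardUnitBundle g' := by
  obtain ⟨⟨hb, hn⟩, he⟩ := h
  have hn' : 0 ≤ innerAt g x ξ (normal g x) := hn
  refine ⟨⟨hb, ?_⟩, energy_jacobi hg (hpos x) (energy_eq_iff.1 he)⟩
  change 0 ≤ innerAt g' x ((jacobiFactor q H₀ x)⁻¹ • ξ) (normal g' x)
  rw [innerAt_normal] at hn' ⊢
  have h0 : 0 ≤ ξ 0 := by
    by_contra hlt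
    exact absurd hn' (not_le.2 (div_neg_of_neg_of_pos (not_le.1 hlt)
      (Real.sqrt_pos.2 (gram_inv_zero_pos g x))))
  exact div_nonneg (mul_nonneg (inv_pos.2 (hpos x)).le h0) (Real.sqrt_nonneg _)

end Jacobi

end PotentialRay

theorem mainTheorem5 {d : ℕ} [NeZero d] {M : Type*} [TopologicalSpace M] [T2Space M]
    [CompactSpace M] [ChartedSpace (EuclideanHalfSpace d) M] [IsManifold (𝓡∂ d) ∞ M]
    (g : PotentialRay.Metric d M) (q : M → ℝ) (hq : ContMDiff (𝓡∂ d) 𝓘(ℝ, ℝ) ∞ q) (H₀ : ℝ)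
    (hsimple : PotentialRay.IsSimpleAtEnergy g q H₀) :
    ∃ g' : PotentialRay.Metric d M,
      -- the metric `g' = 2 (H₀ - q) g`
      (∀ (x : M) (v w : TangentSpace (𝓡∂ d) x),
        g'.inner x v w = 2 * (H₀ - q x) * g.inner x v w) ∧
      PotentialRay.IsSimpleRiemannian g' ∧
      -- `H`-geodesics `γ` of energy `H₀` become unit speed geodesics of `g'` when they are
      -- parametrized by `s(t) = ∫₀ᵗ 2 (H₀ - q(γ(u))) du`; here `r` is the inverse of `s`
      (∀ (T : ℝ) (γ : ℝ → M), 0 < T → PotentialRay.IsHGeodesicOn g q γ (Icc 0 T) →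
        PotentialRay.energy g q (PotentialRay.lift γ (Icc 0 T) 0) = H₀ →
        ∃ (S : ℝ) (r : ℝ → ℝ),
          S = ∫ u in (0 : ℝ)..T, 2 * (H₀ - q (γ u)) ∧ 0 < S ∧
          StrictMonoOn r (Icc 0 S) ∧ BijOn r (Icc 0 S) (Icc 0 T) ∧ ContDiffOn ℝ ∞ r (Icc 0 S) ∧
          (∀ t ∈ Icc 0 T, r (∫ u in (0 : ℝ)..t, 2 * (H₀ - q (γ u))) = t) ∧
          PotentialRay.IsGeodesicOn g' (γ ∘ r) (Icc 0 S) ∧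
          ∀ s ∈ Icc 0 S,
            g'.inner (γ (r s)) (PotentialRay.lift (γ ∘ r) (Icc 0 S) s).2
              (PotentialRay.lift (γ ∘ r) (Icc 0 S) s).2 = 1) ∧
      -- the two ray transforms
      (∀ p ∈ PotentialRay.inwardEnergyBundle g q H₀, ∃ p' ∈ PotentialRay.inwardUnitBundle g',
        -- `p'` is the initial vector of the reparametrized curve
        p' = ⟨p.1, (2 * (H₀ - q p.1))⁻¹ • p.2⟩ ∧
        PotentialRay.exitTime g' (fun _ => 0) p' =
          ∫ u in (0 : ℝ)..PotentialRay.exitTime g q p,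
            2 * (H₀ - q (PotentialRay.flowPoint g q p u)) ∧
        (∀ t ∈ Icc 0 (PotentialRay.exitTime g q p),
          PotentialRay.flowPoint g' (fun _ => 0) p'
            (∫ u in (0 : ℝ)..t, 2 * (H₀ - q (PotentialRay.flowPoint g q p u))) =
          PotentialRay.flowPoint g q p t) ∧
        -- the identity, for every `f` that is integrable along the `H`-geodesic
        ∀ f : M → ℝ,
          IntervalIntegrable (fun t => f (PotentialRay.flowPoint g q p t)) volume 0
            (PotentialRay.exitTime g q p) →
          IntervalIntegrable
            (fun s => f (PotentialRay.flowPoint g' (fun _ => 0) p' s) /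
              (2 * (H₀ - q (PotentialRay.flowPoint g' (fun _ => 0) p' s)))) volume 0
            (PotentialRay.exitTime g' (fun _ => 0) p') ∧
          PotentialRay.flowTransform g q f p =
            PotentialRay.xrayTransform g' (fun x => f x / (2 * (H₀ - q x))) p') := by
  obtain ⟨hconv, hs⟩ := hsimple
  have hpos := PotentialRay.jacobiFactor_pos hs
  have hρ : ContMDiff (𝓡∂ d) 𝓘(ℝ, ℝ) ∞ (PotentialRay.jacobiFactor q H₀) :=
    PotentialRay.contMDiff_jacobiFactor hq
  set g' := PotentialRay.conformalMetric g _ hρ hpos with hg'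
  have hg : ∀ x v w, PotentialRay.innerAt g' x v w =
      PotentialRay.jacobiFactor q H₀ x * PotentialRay.innerAt g x v w :=
    PotentialRay.innerAt_conformalMetric g _ hρ hpos
  refine ⟨g', hg, ⟨PotentialRay.strictlyConvexBoundary_jacobi hq hpos hg hconv,
    PotentialRay.isDiffeoOnto_riemExp hq hg hs⟩, ?_, ?_⟩
  · intro T γ hT hγ hen
    obtain ⟨S, r, hS, hS0, hr1, hr2, hr3, hr4, -, hσ, hv⟩ := hγ.exists_param (E₂ := 1 / 2)
      hρ hpos hg hq (contMDiff_const (c := (0 : ℝ)))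
      (fun x => by rw [PotentialRay.jacobiFactor]; ring) hT hen
    refine ⟨S, r, hS, hS0, hr1, hr2, hr3, hr4, hσ, fun s hsS => ?_⟩
    have h1 : PotentialRay.innerAt g (γ (r s)) (PotentialRay.velocity γ (Icc 0 T) (r s))
        (PotentialRay.velocity γ (Icc 0 T) (r s)) = PotentialRay.jacobiFactor q H₀ (γ (r s)) :=
      PotentialRay.energy_eq_iff.1
        ((PotentialRay.energy_lift_eq hq hT hγ (hr2.mapsTo hsS)).trans hen)
    have h2 := PotentialRay.energy_jacobi hg (hpos _) h1
    rw [← hv s hsS] at h2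
    exact h2
  · rintro ⟨x, ξ⟩ hp
    have hξ := PotentialRay.energy_eq_iff.1 hp.2
    refine ⟨PotentialRay.tangentPoint x ((PotentialRay.jacobiFactor q H₀ x)⁻¹ • ξ),
      PotentialRay.inwardUnitBundle_of_inwardEnergyBundle hpos hg hp, rfl,
      PotentialRay.exitTime_jacobi hq hg hs hξ,
      fun t ht => PotentialRay.flowPoint_jacobi hq hg hs hξ ht,
      fun f hf => PotentialRay.integral_jacobi hq hg hs hξ f hf⟩
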